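/- Let $n\ge 1$ and let $H:\mathbb{R}^n\to\mathbb{R}$ be convex with $H(0)=\min_{\mathbb{R}^n}H=0$ and $H^{-1}(0)=\{0\}$. Let $U\subset\mathbb{R}^n$ be an unbounded open set whose boundary $\partial U$ is nonempty and compact. Write $V\ll U$ if $V$ is open and $\overline V$ is a compact subset of $U$. Let $\mathrm{Lip}_{\mathrm{loc}}(U)$ be the set of functions $w:U\to\mathbb{R}$ that are Lipschitz continuous on every $V\ll U$, and for $w\in\mathrm{Lip}_{\mathrm{loc}}(V)$ put $\|H(Dw)\|_{L^\infty(V)}:=\operatorname{ess\,sup}_{x\in V}H(Dw(x))$. A function $u\in\mathrm{Lip}_{\mathrm{loc}}(U)$ is called absolutely subminimizing (respectively, absolutely superminimizing) for $H$ in $U$ if $$\|H(Du)\|_{L^\infty(V)}\le\|H(Dw)\|_{L^\infty(V)}$$ whenever $V\ll U$ and $w\in\mathrm{Lip}_{\mathrm{loc}}(V)\cap C(\overline V)$ satisfy $w=u$ on $\partial V$ and $w\le u$ (respectively, $w\ge u$) in $V$. Let $u,v\in C(\overline U)$ be bounded, let $u$ be absolutely subminimizing for $H$ in $U$, and let $v$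 be absolutely superminimizing for $H$ in $U$. Then $$u(x)-v(x)\le\max_{y\in\partial U}\bigl(u(y)-v(y)\bigr)\qquad\text{for every }x\in U.$$ -/

import Mathlib

open MeasureTheory Set

namespace ExteriorComparison

/-- The standing assumptions on the Hamiltonian `H : ℝⁿ → ℝ`: it is convex,
`H 0 = min H = 0`, and its zero level set is bounded with empty interior. -/
structure IsHamiltonian {n : ℕ} (H : EuclideanSpace ℝ (Fin n) → ℝ) : Prop where
  convex : ConvexOn ℝ univ H
  map_zero : H 0 = 0
  nonneg : ∀ p, 0 ≤ H p
  bounded_zeroSet : Bornology.IsBounded (H ⁻¹' {0})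
  interior_zeroSet : interior (H ⁻¹' {0}) = ∅

/-- `V ≪ U`, for an open set `V`: the closure of `V` is a compact subset of `U`. -/
structure CompactlyInside {n : ℕ} (V U : Set (EuclideanSpace ℝ (Fin n))) : Prop where
  isOpen : IsOpen V
  isCompact_closure : IsCompact (closure V)
  closure_subset : closure V ⊆ U

/-- `v ∈ Lip_loc(U)`: `v` is Lipschitz continuous on every open `V ≪ U`.
Only the values of `v` on `U` matter. -/
def LipLoc {n : ℕ} (v : EuclideanSpace ℝ (Fin n) → ℝ)
    (U : Set (EuclideanSpace ℝ (Fin n))) : Prop :=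
  ∀ V, CompactlyInside V U → ∃ K : NNReal, LipschitzOnWith K v V

/-- `‖H(Dv)‖_{L^∞(V)} = ess sup_{x ∈ V} H(Dv(x))` with respect to Lebesgue measure, for
`v ∈ Lip_loc(V)` with `V` open; by Rademacher's theorem the gradient exists at almost every
point of `V`. -/
noncomputable def supHD {n : ℕ} (H : EuclideanSpace ℝ (Fin n) → ℝ)
    (v : EuclideanSpace ℝ (Fin n) → ℝ) (V : Set (EuclideanSpace ℝ (Fin n))) : EReal :=
  essSup (fun x => ((H (gradient v x) : ℝ) : EReal)) (volume.restrict V)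

/-- `u` is absolutely subminimizing for `H` in `U`. -/
def AbsSubminimizing {n : ℕ} (H : EuclideanSpace ℝ (Fin n) → ℝ)
    (u : EuclideanSpace ℝ (Fin n) → ℝ) (U : Set (EuclideanSpace ℝ (Fin n))) : Prop :=
  LipLoc u U ∧
    ∀ (V : Set (EuclideanSpace ℝ (Fin n))) (v : EuclideanSpace ℝ (Fin n) → ℝ),
      CompactlyInside V U → LipLoc v V → ContinuousOn v (closure V) →
      (∀ x ∈ frontier V, v x = u x) → (∀ x ∈ V, v x ≤ u x) →
      supHD H u V ≤ supHD H v V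

/-- `u` is absolutely superminimizing for `H` in `U`. -/
def AbsSuperminimizing {n : ℕ} (H : EuclideanSpace ℝ (Fin n) → ℝ)
    (u : EuclideanSpace ℝ (Fin n) → ℝ) (U : Set (EuclideanSpace ℝ (Fin n))) : Prop :=
  LipLoc u U ∧
    ∀ (V : Set (EuclideanSpace ℝ (Fin n))) (v : EuclideanSpace ℝ (Fin n) → ℝ),
      CompactlyInside V U → LipLoc v V → ContinuousOn v (closure V) →
      (∀ x ∈ frontier V, v x = u x) → (∀ x ∈ V, u x ≤ v x) →
      supHD H u V ≤ supHD H v V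

end ExteriorComparison

/-!
An absolutely subminimizing function enjoys comparison with the cone functions
`x ↦ sup {⟪p, x - a⟫ | H p ≤ k}`. By this comparison property the sup-convolutions
`x ↦ sup_y (u y - t L((y - x) / t))`, with `L` the Lagrangian of `H`, are convex in time at
`0, t, 2 t`, which makes the sup-convolution at time `t` a subsolution of a discrete equation in
which each point gains its slope in a single step of length at most `ρ`; symmetrically `-v` yields
a supersolution. The discrete equation has a comparison principle in unbounded sets: where the
slopes are at least `δ > 0`, one can keep moving up by `δ / 2` while staying near the supremum of
the difference, which contradicts boundedness; smaller slopes are raised to `δ` by following chains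
of steps to the complement, whose cost is negligible since `L(q) = o(|q|)`. Finally `ρ → 0`, and the
compactness of the boundary makes the boundary values uniform.
-/

namespace ExteriorComparison

section Discrete

variable {α : Type*} {N : α → α → Prop} {c : α → α → ℝ} {u s v w : α → ℝ} {Y F : Set α} {δ : ℝ}

/-- Discrete subsolutions on `Y`, for moves from `x` to the points `y` with `N x y` at the cost
`c x y`: the best upward slope of `u` at `x` equals `s x`, and no downward slope exceeds it. -/
structure DiscreteSub (N : α → α → Prop) (c : α → α → ℝ) (u s : α → ℝ) (Y : Set α) : Prop where
  sub_cost_le : ∀ x ∈ Y, ∀ y, N x y → u y - c x y ≤ u x + s x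
  exists_eq : ∀ x ∈ Y, ∃ y, N x y ∧ u y - c x y = u x + s x
  sub_le_add_cost : ∀ x ∈ Y, ∀ z, N z x → u x - s x ≤ u z + c z x

/-- Discrete supersolutions on `Y`: some downward slope of `v` at `x` is at least all its upward
slopes. -/
def DiscreteSuper (N : α → α → Prop) (c : α → α → ℝ) (v : α → ℝ) (Y : Set α) : Prop :=
  ∀ x ∈ Y, ∃ z, N z x ∧ ∀ y, N x y → v y - c x y + v z + c z x ≤ 2 * v x

/-- Discrete subsolutions with slopes at least `δ`. The upward slope need not be attained. -/
def StrictDiscreteSub (N : α → α → Prop) (c : α → α → ℝ) (δ : ℝ) (w : α → ℝ) (Y : Set α) : Prop :=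
  ∀ x ∈ Y, ∃ σ ≥ δ, (∀ θ > 0, ∃ y, N x y ∧ w x + σ - θ ≤ w y - c x y) ∧
    ∀ z, N z x → w x - σ ≤ w z + c z x

/-- The values of chains from a point to the set `F`: a chain ends when it meets `F`, where it
collects `u`, and it pays `c x y + δ` for each step from `x` to `y`. -/
inductive ChainValue (N : α → α → Prop) (c : α → α → ℝ) (δ : ℝ) (u : α → ℝ) (F : Set α) :
    α → ℝ → Prop
  | base {x : α} (hx : x ∈ F) : ChainValue N c δ u F x (u x)
  | step {x y : α} {r : ℝ} (hx : x ∉ F) (hN : N x y) (h : ChainValue N c δ u F y r) :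
      ChainValue N c δ u F x (r - c x y - δ)

/-- The points outside `Y`, and those of `Y` at which the slope `s` is at least `δ`. -/
def steepSet (s : α → ℝ) (δ : ℝ) (Y : Set α) : Set α := {x | x ∈ Y → δ ≤ s x}

/-- The patched function: `u` where its slope `s` is at least `δ`, extended with slope `δ` by the
best value of a chain. It is a strict subsolution close to `u`. -/
noncomputable def patch (N : α → α → Prop) (c : α → α → ℝ) (δ : ℝ) (u s : α → ℝ) (Y : Set α)
    (x : α) : ℝ :=
  sSup {r | ChainValue N c δ u (steepSet s δ Y) x r}

theorem DiscreteSub.discreteSuper_neg (hN : ∀ x y, N x y → N y x)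
    (hu : DiscreteSub N c u s Y) : DiscreteSuper N (fun x y => c y x) (fun x => -u x) Y := by
  intro x hx
  obtain ⟨z, hxz, hz⟩ := hu.exists_eq x hx
  refine ⟨z, hN _ _ hxz, fun y hxy => ?_⟩
  have hy := hu.sub_le_add_cost x hx y (hN _ _ hxy)
  linarith

theorem notMem_steepSet {x : α} : x ∉ steepSet s δ Y ↔ x ∈ Y ∧ s x < δ := by
  simp [steepSet]

theorem mem_steepSet_of_notMem {x : α} (hx : x ∉ Y) : x ∈ steepSet s δ Y :=
  fun hxY => absurd hxY hx

theorem ChainValue.eq_of_mem {x : α} {r : ℝ} (h : ChainValue N c δ u F x r) (hx : x ∈ F) :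
    r = u x := by
  cases h with
  | base _ => rfl
  | step hx' _ _ => exact absurd hx hx'

theorem patch_of_mem {x : α} (hx : x ∈ steepSet s δ Y) : patch N c δ u s Y x = u x := by
  have hsingle : {r | ChainValue N c δ u (steepSet s δ Y) x r} = {u x} :=
    Subset.antisymm (fun r h => h.eq_of_mem hx) (singleton_subset_iff.2 (.base hx))
  rw [patch, hsingle, csSup_singleton]

namespace DiscreteSub

theorem chainValue_le (hu : DiscreteSub N c u s Y) {x : α} {r : ℝ}
    (h : ChainValue N c δ u (steepSet s δ Y) x r) : r ≤ u x := by
  induction h with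
  | base _ => exact le_rfl
  | step hx hN _ ih =>
    obtain ⟨hxY, hlt⟩ := notMem_steepSet.1 hx
    linarith [hu.sub_cost_le _ hxY _ hN]

theorem le_patch (hu : DiscreteSub N c u s Y) {x : α} {r : ℝ}
    (h : ChainValue N c δ u (steepSet s δ Y) x r) : r ≤ patch N c δ u s Y x :=
  le_csSup ⟨u x, fun _ => hu.chainValue_le⟩ h

theorem patch_le (hu : DiscreteSub N c u s Y) {x : α}
    (hne : ∃ r, ChainValue N c δ u (steepSet s δ Y) x r) : patch N c δ u s Y x ≤ u x :=
  csSup_le hne fun _ => hu.chainValue_le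

theorem patch_sub_le (hu : DiscreteSub N c u s Y) {x y : α} (hx : x ∉ steepSet s δ Y)
    (hxy : N x y) (hne : ∃ r, ChainValue N c δ u (steepSet s δ Y) y r) :
    patch N c δ u s Y y - c x y - δ ≤ patch N c δ u s Y x := by
  have hy : patch N c δ u s Y y ≤ patch N c δ u s Y x + c x y + δ :=
    csSup_le hne fun r h => by linarith [hu.le_patch (.step hx hxy h)]
  linarith

theorem exists_chainValue (hN : ∀ x y, N x y → N y x) (hc : ∀ x y, 0 ≤ c x y) (hδ : 0 ≤ δ)
    (hu : DiscreteSub N c u s Y) {k : ℕ} {γ : ℕ → α} (hend : γ k ∉ Y)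
    (hγ : ∀ i < k, N (γ i) (γ (i + 1))) :
    ∃ r, ChainValue N c δ u (steepSet s δ Y) (γ 0) r ∧ u (γ 0) - 2 * k * δ -
      ∑ i ∈ Finset.range k, (c (γ i) (γ (i + 1)) + c (γ (i + 1)) (γ i)) ≤ r := by
  induction k generalizing γ with
  | zero => exact ⟨u (γ 0), .base (mem_steepSet_of_notMem hend), by simp⟩
  | succ k ih =>
    have hsum : 0 ≤ ∑ i ∈ Finset.range (k + 1), (c (γ i) (γ (i + 1)) + c (γ (i + 1)) (γ i)) :=
      Finset.sum_nonneg fun i _ => add_nonneg (hc _ _) (hc _ _)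
    by_cases hsteep : γ 0 ∈ steepSet s δ Y
    · have hkδ : 0 ≤ 2 * ((k + 1 : ℕ) : ℝ) * δ := by positivity
      exact ⟨u (γ 0), .base hsteep, by linarith⟩
    · obtain ⟨r, hr, hle⟩ := ih (γ := fun i => γ (i + 1)) hend fun i hi => hγ (i + 1) (by lia)
      obtain ⟨hY, hlt⟩ := notMem_steepSet.1 hsteep
      have hstep : N (γ 0) (γ 1) := hγ 0 (by lia)
      have hdown := hu.sub_le_add_cost (γ 0) hY (γ 1) (hN _ _ hstep)
      refine ⟨_, .step hsteep hstep hr, ?_⟩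
      rw [Finset.sum_range_succ']
      push_cast
      simp only [zero_add] at hle ⊢
      linarith

theorem strictDiscreteSub_patch (hu : DiscreteSub N c u s Y)
    (hne : ∀ x, ∃ r, ChainValue N c δ u (steepSet s δ Y) x r) :
    StrictDiscreteSub N c δ (patch N c δ u s Y) Y := by
  intro x hxY
  by_cases hx : x ∈ steepSet s δ Y
  · have hsx : δ ≤ s x := hx hxY
    rw [patch_of_mem hx]
    refine ⟨s x, hsx, fun θ hθ => ?_, fun z hz => ?_⟩
    · obtain ⟨y, hxy, hy⟩ := hu.exists_eq x hxY
      -- The optimal neighbour `y` sees `x` below it with slope `s x`, so it is steep as well.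
      have hysteep : y ∈ steepSet s δ Y := fun hyY => by
        linarith [hu.sub_le_add_cost y hyY x hxy]
      exact ⟨y, hxy, by rw [patch_of_mem hysteep]; linarith⟩
    · by_cases hzsteep : z ∈ steepSet s δ Y
      · rw [patch_of_mem hzsteep]
        exact hu.sub_le_add_cost x hxY z hz
      · have hzx := hu.patch_sub_le hzsteep hz (hne x)
        rw [patch_of_mem hx] at hzx
        linarith
  · obtain ⟨-, hsx⟩ := notMem_steepSet.1 hx
    refine ⟨δ, le_rfl, fun θ hθ => ?_, fun z hz => ?_⟩
    · obtain ⟨r, hr, hlt⟩ := exists_lt_of_lt_csSup (hne x) (sub_lt_self _ hθ)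
      cases hr with
      | base h => exact absurd h hx
      | @step _ y r hx' hxy hr =>
        exact ⟨y, hxy, by linarith [hu.le_patch hr, show patch N c δ u s Y x - θ < _ from hlt]⟩
    · by_cases hzsteep : z ∈ steepSet s δ Y
      · rw [patch_of_mem hzsteep]
        linarith [hu.sub_le_add_cost x hxY z hz, hu.patch_le (hne x)]
      · linarith [hu.patch_sub_le hzsteep hz (hne x)]

end DiscreteSub

theorem StrictDiscreteSub.exists_add_sub_le {A η : ℝ} (hw : StrictDiscreteSub N c δ w Y)
    (hv : DiscreteSuper N c v Y) (hc : ∀ x y, 0 ≤ c x y) (hA : ∀ z, w z - v z ≤ A) (hη : 0 < η)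
    {x : α} (hx : x ∈ Y) (hxA : A - η ≤ w x - v x) :
    ∃ y, A - 3 * η ≤ w y - v y ∧ w x + δ - η ≤ w y := by
  obtain ⟨σ, hσ, hup, hdown⟩ := hw x hx
  obtain ⟨z, hzx, hz⟩ := hv x hx
  obtain ⟨y, hxy, hy⟩ := hup η hη
  exact ⟨y, by linarith [hz y hxy, hdown z hzx, hA z], by linarith [hc x y]⟩

theorem StrictDiscreteSub.exists_sub_le_and_add_mul_le {A a m : ℝ} (hδ : 0 < δ)
    (hw : StrictDiscreteSub N c δ w Y) (hv : DiscreteSuper N c v Y) (hc : ∀ x y, 0 ≤ c x y)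
    (hA : ∀ z, w z - v z ≤ A) (hmA : m < A) (hm : ∀ x ∉ Y, w x - v x ≤ m)
    (hstart : ∀ ε > 0, ∃ y, A - ε ≤ w y - v y ∧ a ≤ w y) (i : ℕ) :
    ∀ ε > 0, ∃ y, A - ε ≤ w y - v y ∧ a + i * (δ / 2) ≤ w y := by
  induction i with
  | zero => simpa using hstart
  | succ i ih =>
    intro ε hε
    set η := min (ε / 3) (min (δ / 2) ((A - m) / 2))
    have hη : 0 < η := by
      have := sub_pos.2 hmA
      positivity
    have hηε : η ≤ ε / 3 := min_le_left _ _
    have hηδ : η ≤ δ / 2 := (min_le_right _ _).trans (min_le_left _ _)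
    have hηm : η ≤ (A - m) / 2 := (min_le_right _ _).trans (min_le_right _ _)
    obtain ⟨y, hyA, hy⟩ := ih η hη
    have hyY : y ∈ Y := by
      by_contra hyY
      linarith [hm y hyY]
    obtain ⟨y', hy'A, hy'⟩ := hw.exists_add_sub_le hv hc hA hη hyY hyA
    refine ⟨y', by linarith, ?_⟩
    push_cast
    linarith

theorem StrictDiscreteSub.sub_le {m : ℝ} (hδ : 0 < δ) (hw : StrictDiscreteSub N c δ w Y)
    (hv : DiscreteSuper N c v Y) (hc : ∀ x y, 0 ≤ c x y) (hw_bdd : BddAbove (range w))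
    (hv_bdd : BddBelow (range v)) (hm : ∀ x ∉ Y, w x - v x ≤ m) (x : α) : w x - v x ≤ m := by
  obtain ⟨B, hB⟩ := hw_bdd
  obtain ⟨b, hb⟩ := hv_bdd
  replace hB : ∀ y, w y ≤ B := fun y => hB (mem_range_self y)
  replace hb : ∀ y, b ≤ v y := fun y => hb (mem_range_self y)
  by_contra! hx
  set A := ⨆ y, (w y - v y)
  have hA : ∀ y, w y - v y ≤ A :=
    le_ciSup ⟨B - b, by rintro _ ⟨y, rfl⟩; exact sub_le_sub (hB y) (hb y)⟩
  have hstart : ∀ ε > 0, ∃ y, A - ε ≤ w y - v y ∧ A - 1 + b ≤ w y := fun ε hε => by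
    have : Nonempty α := ⟨x⟩
    obtain ⟨y, hy⟩ := exists_lt_of_lt_ciSup (sub_lt_self A (lt_min hε one_pos))
    exact ⟨y, by linarith [min_le_left ε 1], by linarith [min_le_right ε 1, hb y]⟩
  obtain ⟨k, hk⟩ := exists_nat_gt ((B - (A - 1 + b)) / (δ / 2))
  obtain ⟨y, -, hy⟩ := hw.exists_sub_le_and_add_mul_le hδ hv hc hA (hx.trans_le (hA x)) hm
    hstart k 1 one_pos
  rw [div_lt_iff₀ (by positivity)] at hk
  linarith [hB y]

theorem DiscreteSub.sub_le {m : ℝ} (hN : ∀ x y, N x y → N y x) (hc : ∀ x y, 0 ≤ c x y)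
    (hu : DiscreteSub N c u s Y) (hv : DiscreteSuper N c v Y) (hu_bdd : BddAbove (range u))
    (hv_bdd : BddBelow (range v)) (hm : ∀ x ∉ Y, u x - v x ≤ m)
    (hchain : ∀ x, ∀ η > 0, ∃ (k : ℕ) (γ : ℕ → α), γ 0 = x ∧ γ k ∉ Y ∧
      (∀ i < k, N (γ i) (γ (i + 1))) ∧
      ∑ i ∈ Finset.range k, (c (γ i) (γ (i + 1)) + c (γ (i + 1)) (γ i)) ≤ η)
    (x : α) : u x - v x ≤ m := by
  refine le_of_forall_pos_le_add fun ε hε => ?_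
  obtain ⟨k, γ, rfl, hend, hγ, hcost⟩ := hchain x (ε / 2) (by positivity)
  obtain ⟨δ, hδ, hkδ⟩ : ∃ δ : ℝ, 0 < δ ∧ 2 * k * δ ≤ ε / 2 := by
    refine ⟨ε / (4 * (k + 1)), by positivity, ?_⟩
    rw [mul_div_assoc', div_le_div_iff₀ (by positivity) (by positivity)]
    nlinarith
  have hne (y : α) : ∃ r, ChainValue N c δ u (steepSet s δ Y) y r := by
    obtain ⟨l, β, rfl, hβend, hβ, -⟩ := hchain y 1 one_pos
    exact (hu.exists_chainValue hN hc hδ.le hβend hβ).imp fun _ => And.left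
  obtain ⟨r, hr, hle⟩ := hu.exists_chainValue hN hc hδ.le hend hγ
  obtain ⟨B, hB⟩ := hu_bdd
  have hpatch_bdd : BddAbove (range (patch N c δ u s Y)) :=
    ⟨B, by rintro _ ⟨y, rfl⟩; exact (hu.patch_le (hne y)).trans (hB (mem_range_self y))⟩
  have hpatch := (hu.strictDiscreteSub_patch hne).sub_le hδ hv hc hpatch_bdd hv_bdd
    (fun y hy => by rw [patch_of_mem (mem_steepSet_of_notMem hy)]; exact hm y hy) (γ 0)
  linarith [hu.le_patch hr]

end Discrete

section Segment

open Filter Topology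

theorem sub_le_of_ae_deriv_le {f : ℝ → ℝ} {K : NNReal} {M : ℝ}
    (hf : LipschitzOnWith K f (Icc 0 1)) (h : ∀ᵐ s, s ∈ Ioo (0 : ℝ) 1 → deriv f s ≤ M) :
    f 1 - f 0 ≤ M := by
  have hac : AbsolutelyContinuousOnInterval f 0 1 :=
    LipschitzOnWith.absolutelyContinuousOnInterval (K := K) (by rwa [uIcc_of_le zero_le_one])
  have hint : ∫ s in (0 : ℝ)..1, deriv f s ≤ ∫ _s in (0 : ℝ)..1, M := by
    apply intervalIntegral.integral_mono_ae_restrict zero_le_one hac.intervalIntegrable_deriv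
      intervalIntegrable_const
    rwa [EventuallyLE, ← restrict_Ioo_eq_restrict_Icc, ae_restrict_iff' measurableSet_Ioo]
  simpa [hac.integral_deriv_eq_sub] using hint

variable {E : Type*} [NormedAddCommGroup E] [NormedSpace ℝ E] [FiniteDimensional ℝ E]
  [MeasurableSpace E] [BorelSpace E] {μ : Measure E} [μ.IsAddHaarMeasure]

theorem ae_ae_add_smul_of_ae {p : E → Prop} (h : ∀ᵐ x ∂μ, p x) (v : E) :
    ∀ᵐ y ∂μ, ∀ᵐ s : ℝ, p (y + s • v) := by
  have hnull : ∀ᵐ x ∂μ, x ∈ (toMeasurable μ {x | ¬ p x})ᶜ :=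
    measure_eq_zero_iff_ae_notMem.1 ((measure_toMeasurable _).trans h)
  have hline := (ae_ae_add_linearMap_mem_iff (LinearMap.toSpanSingleton ℝ E v) volume μ
    (measurableSet_toMeasurable μ {x | ¬ p x}).compl).2 hnull
  filter_upwards [hline] with y hy
  filter_upwards [hy] with s hs
  by_contra hp
  exact hs (subset_toMeasurable _ _ hp)

theorem ae_sub_le_of_ae_fderiv_le {W : Set E} (hW : IsOpen W) {u : E → ℝ} {K : NNReal}
    (hu : LipschitzOnWith K u W) {v : E} {M : ℝ} (h : ∀ᵐ x ∂μ, x ∈ W → fderiv ℝ u x v ≤ M) :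
    ∀ᵐ y ∂μ, (∀ s ∈ Icc (0 : ℝ) 1, y + s • v ∈ W) → u (y + v) - u y ≤ M := by
  have hdiff : ∀ᵐ x ∂μ, x ∈ W → DifferentiableAt ℝ u x ∧ fderiv ℝ u x v ≤ M := by
    filter_upwards [h, hu.ae_differentiableWithinAt_of_mem (μ := μ)] with x hx hxd hxW
    exact ⟨(hxd hxW).differentiableAt (hW.mem_nhds hxW), hx hxW⟩
  filter_upwards [ae_ae_add_smul_of_ae hdiff v] with y hy hseg
  have hline : LipschitzWith ‖v‖₊ fun s : ℝ => y + s • v := by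
    refine LipschitzWith.of_dist_le_mul fun a b => ?_
    rw [dist_add_left, dist_eq_norm, ← sub_smul, norm_smul, mul_comm, Real.dist_eq,
      Real.norm_eq_abs, coe_nnnorm]
  have hderiv : ∀ᵐ s : ℝ, s ∈ Ioo (0 : ℝ) 1 → deriv (fun s : ℝ => u (y + s • v)) s ≤ M := by
    filter_upwards [hy] with s hs hs01
    obtain ⟨hd, hle⟩ := hs (hseg s (Ioo_subset_Icc_self hs01))
    have hl : HasDerivAt (fun s : ℝ => y + s • v) v s := by
      simpa using ((hasDerivAt_id s).smul_const v).const_add y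
    exact (hd.hasFDerivAt.comp_hasDerivAt s hl).deriv.trans_le hle
  simpa using sub_le_of_ae_deriv_le (hu.comp hline.lipschitzOnWith hseg) hderiv

theorem sub_le_of_ae_fderiv_le (μ : Measure E) [μ.IsAddHaarMeasure] {W : Set E} (hW : IsOpen W)
    {u : E → ℝ} {K : NNReal} (hu : LipschitzOnWith K u W) {y v : E} {M : ℝ}
    (h : ∀ᵐ x ∂μ, x ∈ W → fderiv ℝ u x v ≤ M) (hseg : ∀ s ∈ Icc (0 : ℝ) 1, y + s • v ∈ W) :
    u (y + v) - u y ≤ M := by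
  have hnear : ∀ᶠ z in 𝓝 y, ∀ s ∈ Icc (0 : ℝ) 1, z + s • v ∈ W := by
    refine isCompact_Icc.eventually_forall_of_forall_eventually fun s hs => ?_
    have hcont : Continuous fun q : E × ℝ => q.1 + q.2 • v := by fun_prop
    exact hcont.continuousAt.eventually_mem (hW.mem_nhds (hseg s hs))
  have hcont : ContinuousAt (fun z => u (z + v) - u z) y := by
    have hy : ContinuousAt u y :=
      hu.continuousOn.continuousAt (hW.mem_nhds (by simpa using hseg 0 (by simp)))
    have hyv : ContinuousAt u (y + v) :=
      hu.continuousOn.continuousAt (hW.mem_nhds (by simpa using hseg 1 (by simp)))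
    exact (hyv.comp (f := fun z => z + v) (by fun_prop)).sub hy
  by_contra! hlt
  obtain ⟨O, hO, hO_open, hyO⟩ :=
    eventually_nhds_iff.1 (hnear.and (hcont.eventually_const_lt hlt))
  obtain ⟨z, hzO, hz⟩ := (Measure.dense_of_ae
    (ae_sub_le_of_ae_fderiv_le hW hu h)).inter_open_nonempty O hO_open ⟨y, hyO⟩
  exact (hO z hzO).2.not_ge (hz (hO z hzO).1)

end Segment

section Conjugate

open Filter Topology

theorem exists_le_add_mul_sub_of_concaveOn {S : Set ℝ} {f : ℝ → ℝ} (hf : ConcaveOn ℝ S f) {x : ℝ}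
    (hx : x ∈ interior S) : ∃ d, ∀ y ∈ S, f y ≤ f x + d * (y - x) := by
  have hconv : ConvexOn ℝ S (-f) := hf.neg
  refine ⟨-derivWithin (-f) (Ioi x) x, fun y hy => ?_⟩
  rcases lt_trichotomy y x with hyx | rfl | hxy
  · have hslope := (hconv.slope_le_leftDeriv_of_mem_interior hy hx hyx).trans
      (hconv.leftDeriv_le_rightDeriv_of_mem_interior hx)
    rw [slope_def_field, div_le_iff₀ (sub_pos.2 hyx), Pi.neg_apply, Pi.neg_apply] at hslope
    linarith
  · simp
  · have hslope := hconv.rightDeriv_le_slope_of_mem_interior hx hy hxy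
    rw [slope_def_field, le_div_iff₀ (sub_pos.2 hxy), Pi.neg_apply, Pi.neg_apply] at hslope
    linarith

variable {E : Type*} [NormedAddCommGroup E] [InnerProductSpace ℝ E]

/-- The supremum of the affine functions `z ↦ ⟪p, z⟫ - g p`, `p ∈ P`: support functions and
(truncated) Legendre transforms are of this form. -/
noncomputable def supAffine (P : Set E) (g : E → ℝ) (z : E) : ℝ :=
  sSup ((fun p => inner ℝ p z - g p) '' P)

section SupAffine

variable {P : Set E} {g : E → ℝ}

theorem exists_eq_supAffine (hP : IsCompact P) (hne : P.Nonempty) (hg : Continuous g) (z : E) :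
    ∃ p ∈ P, inner ℝ p z - g p = supAffine P g z := by
  have hcont : Continuous fun p => inner ℝ p z - g p := by fun_prop
  obtain ⟨p, hp, hmax⟩ := hP.exists_sSup_image_eq hne hcont.continuousOn
  exact ⟨p, hp, hmax.symm⟩

theorem le_supAffine (hP : IsCompact P) (hg : Continuous g) {p : E} (hp : p ∈ P) (z : E) :
    inner ℝ p z - g p ≤ supAffine P g z := by
  have hcont : Continuous fun p => inner ℝ p z - g p := by fun_prop
  exact le_csSup (hP.bddAbove_image hcont.continuousOn) (mem_image_of_mem _ hp)

theorem supAffine_le (hne : P.Nonempty) {z : E} {M : ℝ}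
    (h : ∀ p ∈ P, inner ℝ p z - g p ≤ M) : supAffine P g z ≤ M :=
  csSup_le (hne.image _) (forall_mem_image.2 h)

theorem convexOn_supAffine (hP : IsCompact P) (hne : P.Nonempty) (hg : Continuous g) :
    ConvexOn ℝ univ (supAffine P g) := by
  refine ⟨convex_univ, fun x _ y _ a b ha hb hab => supAffine_le hne fun p hp => ?_⟩
  rw [inner_add_right, inner_smul_right, inner_smul_right, smul_eq_mul, smul_eq_mul]
  calc a * inner ℝ p x + b * inner ℝ p y - g p
      = a * (inner ℝ p x - g p) + b * (inner ℝ p y - g p) := by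
        linear_combination g p * hab
    _ ≤ a * supAffine P g x + b * supAffine P g y := by
        gcongr <;> exact le_supAffine hP hg hp _

theorem exists_lipschitzWith_supAffine (hP : IsCompact P) (hne : P.Nonempty)
    (hg : Continuous g) : ∃ K, LipschitzWith K (supAffine P g) := by
  obtain ⟨R, hR⟩ := hP.isBounded.exists_norm_le
  refine ⟨R.toNNReal, LipschitzWith.of_le_add_mul _ fun x y => supAffine_le hne fun p hp => ?_⟩
  have hinner : inner ℝ p (x - y) ≤ R.toNNReal * dist x y := by
    refine (real_inner_le_norm _ _).trans ?_
    rw [dist_eq_norm]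
    gcongr
    exact (hR p hp).trans (Real.le_coe_toNNReal R)
  rw [inner_sub_right] at hinner
  linarith [le_supAffine hP hg hp y]

theorem continuous_supAffine (hP : IsCompact P) (hne : P.Nonempty) (hg : Continuous g) :
    Continuous (supAffine P g) :=
  let ⟨_, hK⟩ := exists_lipschitzWith_supAffine hP hne hg
  hK.continuous

theorem supAffine_comp_neg : supAffine (-P) (fun p => g (-p)) = fun z => supAffine P g (-z) := by
  ext z
  simp only [supAffine, ← image_neg_eq_neg, image_image, neg_neg, inner_neg_left, inner_neg_right]

end SupAffine

/-- Convex Hamiltonians that vanish at the origin and are positive elsewhere. -/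
structure PosConvex (H : E → ℝ) : Prop where
  convex : ConvexOn ℝ univ H
  map_zero : H 0 = 0
  pos : ∀ p, p ≠ 0 → 0 < H p

/-- The sublevel set `{H ≤ k}`. -/
def sublevel (H : E → ℝ) (k : ℝ) : Set E := {p | H p ≤ k}

/-- The cone function of slope `k`, which is the support function of `{H ≤ k}`: the largest
function with `H(Dw) ≤ k` that vanishes at the origin. -/
noncomputable def cone (H : E → ℝ) (k : ℝ) : E → ℝ := supAffine (sublevel H k) 0

/-- The Lagrangian of `H`, with momenta restricted to the compact set `{H ≤ J}` so that it is
finite even if `H` grows only linearly. -/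
noncomputable def lagrangian (H : E → ℝ) (J : ℝ) : E → ℝ := supAffine (sublevel H J) H

/-- The cone function of slope `J` exceeds that of slope `k` by at least the norm. This is how
large the truncation level `J` has to be for the slope `k` to be visible to `lagrangian H J`. -/
structure SteepAbove (H : E → ℝ) (k J : ℝ) : Prop where
  lt : k < J
  cone_add_norm_le : ∀ z, cone H k z + ‖z‖ ≤ cone H J z

/-- The gap `L(q) + k - cone H k q` in Young's inequality. It is nonnegative for `k ∈ [0, J]`. -/
noncomputable def youngGap (H : E → ℝ) (J k : ℝ) (q : E) : ℝ := lagrangian H J q + k - cone H k q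

/-- The points that precede, on their ray from the origin, all zeros of `youngGap H J k`. -/
def preContact (H : E → ℝ) (J k : ℝ) : Set E :=
  {q | ∀ s ∈ Icc (0 : ℝ) 1, 0 < youngGap H J k (s • q)}

theorem notMem_preContact {H : E → ℝ} {J k : ℝ} {q : E} :
    q ∉ preContact H J k ↔ ∃ s ∈ Icc (0 : ℝ) 1, youngGap H J k (s • q) ≤ 0 := by
  simp only [preContact, mem_ofPred_eq, not_forall, not_lt, exists_prop]

theorem lagrangian_comp_neg (H : E → ℝ) (J : ℝ) (q : E) :
    lagrangian (fun p => H (-p)) J q = lagrangian H J (-q) :=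
  congrFun (supAffine_comp_neg (P := sublevel H J) (g := H)) q

namespace PosConvex

variable {H : E → ℝ} {J k : ℝ}

theorem nonneg (hH : PosConvex H) (p : E) : 0 ≤ H p := by
  rcases eq_or_ne p 0 with rfl | hp
  · exact hH.map_zero.ge
  · exact (hH.pos p hp).le

theorem comp_neg (hH : PosConvex H) : PosConvex fun p => H (-p) where
  convex := hH.convex.comp_linearMap (-LinearMap.id)
  map_zero := by simpa using hH.map_zero
  pos p hp := hH.pos _ (neg_ne_zero.2 hp)

theorem map_smul_le (hH : PosConvex H) {a : ℝ} (ha₀ : 0 ≤ a) (ha₁ : a ≤ 1) (p : E) :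
    H (a • p) ≤ a * H p := by
  simpa [hH.map_zero] using
    hH.convex.2 (mem_univ p) (mem_univ 0) ha₀ (sub_nonneg.2 ha₁) (add_sub_cancel a 1)

theorem zero_mem_sublevel (hH : PosConvex H) (hk : 0 ≤ k) : (0 : E) ∈ sublevel H k :=
  hH.map_zero.trans_le hk

theorem sublevel_nonempty (hH : PosConvex H) (hk : 0 ≤ k) : (sublevel H k).Nonempty :=
  ⟨0, hH.zero_mem_sublevel hk⟩

theorem cone_le (hH : PosConvex H) (hk : 0 ≤ k) {z : E} {M : ℝ}
    (h : ∀ p, H p ≤ k → inner ℝ p z ≤ M) : cone H k z ≤ M :=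
  supAffine_le (hH.sublevel_nonempty hk) fun p hp => by simpa using h p hp

theorem lagrangian_le (hH : PosConvex H) (hJ : 0 ≤ J) {q : E} {M : ℝ}
    (h : ∀ p, H p ≤ J → inner ℝ p q - H p ≤ M) : lagrangian H J q ≤ M :=
  supAffine_le (hH.sublevel_nonempty hJ) h

variable [FiniteDimensional ℝ E]

theorem continuous (hH : PosConvex H) : Continuous H := by
  rw [← continuousOn_univ]
  exact hH.convex.continuousOn isOpen_univ

theorem exists_mul_norm_sub_le (hH : PosConvex H) {ε : ℝ} (hε : 0 < ε) :
    ∃ c > 0, ∀ p, c * (‖p‖ - ε) ≤ H p := by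
  have := FiniteDimensional.proper_real E
  obtain ⟨c, hc, hsphere⟩ : ∃ c > 0, ∀ e ∈ Metric.sphere (0 : E) ε, c * ε ≤ H e := by
    rcases (Metric.sphere (0 : E) ε).eq_empty_or_nonempty with hempty | hne
    · exact ⟨1, one_pos, by simp [hempty]⟩
    · obtain ⟨e, he, hmin⟩ := (isCompact_sphere (0 : E) ε).exists_isMinOn hne
        hH.continuous.continuousOn
      refine ⟨H e / ε, div_pos (hH.pos e ?_) hε, fun p hp => ?_⟩
      · rintro rfl
        simp [hε.ne] at he
      · rw [div_mul_cancel₀ _ hε.ne']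
        exact hmin hp
  refine ⟨c, hc, fun p => ?_⟩
  rcases le_total ‖p‖ ε with hp | hp
  · exact (mul_nonpos_of_nonneg_of_nonpos hc.le (sub_nonpos.2 hp)).trans (hH.nonneg p)
  · have hp0 : 0 < ‖p‖ := hε.trans_le hp
    have hmem : (ε / ‖p‖) • p ∈ Metric.sphere (0 : E) ε := by
      simp [norm_smul, abs_of_pos hε, div_mul_cancel₀ _ hp0.ne']
    have hradial : c * ε ≤ ε / ‖p‖ * H p :=
      (hsphere _ hmem).trans (hH.map_smul_le (by positivity) ((div_le_one hp0).2 hp) p)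
    rw [div_mul_eq_mul_div, le_div_iff₀ hp0] at hradial
    have hcp : c * ‖p‖ ≤ H p := le_of_mul_le_mul_left (by linarith) hε
    linarith [mul_pos hc hε]

theorem isCompact_sublevel (hH : PosConvex H) (k : ℝ) : IsCompact (sublevel H k) := by
  have := FiniteDimensional.proper_real E
  obtain ⟨c, hc, hcH⟩ := hH.exists_mul_norm_sub_le one_pos
  refine Metric.isCompact_of_isClosed_isBounded (isClosed_le hH.continuous continuous_const)
    (isBounded_iff_forall_norm_le.2 ⟨k / c + 1, fun p hp => ?_⟩)
  rw [← sub_le_iff_le_add, le_div_iff₀' hc]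
  exact (hcH p).trans hp

section Cone

theorem inner_le_cone (hH : PosConvex H) {p : E} (hp : H p ≤ k) (z : E) :
    inner ℝ p z ≤ cone H k z := by
  simpa [cone] using le_supAffine (hH.isCompact_sublevel k) continuous_zero (p := p) hp z

theorem exists_inner_eq_cone (hH : PosConvex H) (hk : 0 ≤ k) (z : E) :
    ∃ p, H p ≤ k ∧ inner ℝ p z = cone H k z := by
  obtain ⟨p, hp, h⟩ := exists_eq_supAffine (hH.isCompact_sublevel k) (hH.sublevel_nonempty hk)
    continuous_zero z
  exact ⟨p, hp, by simpa [cone] using h⟩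

theorem cone_nonneg (hH : PosConvex H) (hk : 0 ≤ k) (z : E) : 0 ≤ cone H k z := by
  simpa using hH.inner_le_cone (hH.zero_mem_sublevel hk) z

theorem cone_zero (hH : PosConvex H) (hk : 0 ≤ k) : cone H k 0 = 0 :=
  le_antisymm (hH.cone_le hk fun p _ => by simp) (hH.cone_nonneg hk 0)

theorem cone_add_le (hH : PosConvex H) (hk : 0 ≤ k) (y z : E) :
    cone H k (y + z) ≤ cone H k y + cone H k z :=
  hH.cone_le hk fun p hp => by
    rw [inner_add_right]
    exact add_le_add (hH.inner_le_cone hp y) (hH.inner_le_cone hp z)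

theorem cone_smul (hH : PosConvex H) (hk : 0 ≤ k) {s : ℝ} (hs : 0 ≤ s) (z : E) :
    cone H k (s • z) = s * cone H k z := by
  apply le_antisymm
  · refine hH.cone_le hk fun p hp => ?_
    rw [inner_smul_right]
    exact mul_le_mul_of_nonneg_left (hH.inner_le_cone hp z) hs
  · obtain ⟨p, hp, hpz⟩ := hH.exists_inner_eq_cone hk z
    rw [← hpz, ← inner_smul_right]
    exact hH.inner_le_cone hp _

theorem cone_mono (hH : PosConvex H) (hk : 0 ≤ k) (hkJ : k ≤ J) (z : E) :
    cone H k z ≤ cone H J z :=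
  hH.cone_le hk fun _ hp => hH.inner_le_cone (hp.trans hkJ) z

theorem exists_lipschitzWith_cone (hH : PosConvex H) (hk : 0 ≤ k) :
    ∃ K, LipschitzWith K (cone H k) :=
  exists_lipschitzWith_supAffine (hH.isCompact_sublevel k) (hH.sublevel_nonempty hk)
    continuous_zero

theorem continuous_cone (hH : PosConvex H) (hk : 0 ≤ k) : Continuous (cone H k) :=
  continuous_supAffine (hH.isCompact_sublevel k) (hH.sublevel_nonempty hk) continuous_zero

theorem mul_norm_le_cone (hH : PosConvex H) {A : ℝ} (hA : 0 ≤ A)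
    (h : Metric.closedBall 0 A ⊆ sublevel H k) (z : E) : A * ‖z‖ ≤ cone H k z := by
  rcases eq_or_ne z 0 with rfl | hz
  · have hk : 0 ≤ k := hH.map_zero.ge.trans (h (Metric.mem_closedBall_self hA))
    simp [hH.cone_zero hk]
  · have hz' := norm_pos_iff.2 hz
    have hmem : (A / ‖z‖) • z ∈ Metric.closedBall (0 : E) A := by
      simp [norm_smul, abs_of_nonneg hA, div_mul_cancel₀ _ hz'.ne']
    calc A * ‖z‖ = inner ℝ ((A / ‖z‖) • z) z := by
          rw [real_inner_smul_left, real_inner_self_eq_norm_sq]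
          field_simp
      _ ≤ cone H k z := hH.inner_le_cone (h hmem) z

theorem exists_mul_norm_le_cone (hH : PosConvex H) (A : ℝ) :
    ∃ k₀, 0 ≤ k₀ ∧ ∀ k, k₀ ≤ k → ∀ z, A * ‖z‖ ≤ cone H k z := by
  have := FiniteDimensional.proper_real E
  obtain ⟨k₀, hk₀⟩ := (isCompact_closedBall (0 : E) |A|).bddAbove_image
    hH.continuous.continuousOn
  have hball : Metric.closedBall 0 |A| ⊆ sublevel H k₀ := fun p hp =>
    hk₀ (mem_image_of_mem H hp)
  refine ⟨k₀, hH.map_zero.ge.trans (hball (Metric.mem_closedBall_self (abs_nonneg A))),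
    fun k hk z => ?_⟩
  calc A * ‖z‖ ≤ |A| * ‖z‖ := by gcongr; exact le_abs_self A
    _ ≤ cone H k z := hH.mul_norm_le_cone (abs_nonneg A) (fun p hp => (hball hp).trans hk) z

theorem exists_forall_steepAbove (hH : PosConvex H) (hk : 0 ≤ k) :
    ∃ J₀, 0 ≤ J₀ ∧ ∀ J > J₀, SteepAbove H k J := by
  obtain ⟨K, hK⟩ := hH.exists_lipschitzWith_cone hk
  obtain ⟨k₀, -, h⟩ := hH.exists_mul_norm_le_cone (K + 1)
  refine ⟨max k k₀, hk.trans (le_max_left _ _), fun J hJ =>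
    ⟨(le_max_left _ _).trans_lt hJ, fun z => ?_⟩⟩
  have hsteep := h J ((le_max_right _ _).trans hJ.le) z
  have hlip := hK.dist_le_mul z 0
  rw [hH.cone_zero hk, dist_zero_right, dist_zero_right, Real.norm_eq_abs] at hlip
  linarith [le_abs_self (cone H k z)]

theorem steepAbove_of_le (hH : PosConvex H) {k' : ℝ} (hk' : 0 ≤ k') (hle : k' ≤ k)
    (h : SteepAbove H k J) : SteepAbove H k' J where
  lt := hle.trans_lt h.lt
  cone_add_norm_le z := by linarith [hH.cone_mono hk' hle z, h.cone_add_norm_le z]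

/-- The convex set `{H ≤ k}` is determined by its support function (Hahn–Banach). -/
theorem le_of_forall_inner_le_cone (hH : PosConvex H) (hk : 0 ≤ k) {p : E}
    (h : ∀ z, inner ℝ p z ≤ cone H k z) : H p ≤ k := by
  by_contra hp
  have := FiniteDimensional.complete ℝ E
  have hconv : Convex ℝ (sublevel H k) := by simpa [sublevel] using hH.convex.convex_le k
  obtain ⟨f, s, hfs, hsf⟩ := geometric_hahn_banach_closed_point hconv
    (hH.isCompact_sublevel k).isClosed hp
  obtain ⟨z, rfl⟩ := (InnerProductSpace.toDual ℝ E).surjective f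
  simp only [InnerProductSpace.toDual_apply_apply, fun q => real_inner_comm q z] at hfs hsf
  linarith [h z, hH.cone_le hk fun q hq => (hfs q hq).le]

theorem concaveOn_cone (hH : PosConvex H) (z : E) :
    ConcaveOn ℝ (Ici 0) fun k => cone H k z := by
  refine ⟨convex_Ici 0, fun j hj k hk a b ha hb hab => ?_⟩
  obtain ⟨p, hp, hpz⟩ := hH.exists_inner_eq_cone hj z
  obtain ⟨q, hq, hqz⟩ := hH.exists_inner_eq_cone hk z
  simp only [← hpz, ← hqz, smul_eq_mul, ← real_inner_smul_left, ← inner_add_left]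
  refine hH.inner_le_cone ((hH.convex.2 (mem_univ p) (mem_univ q) ha hb hab).trans ?_) z
  simp only [smul_eq_mul]
  gcongr

end Cone

section Lagrangian

theorem continuous_lagrangian (hH : PosConvex H) (hJ : 0 ≤ J) : Continuous (lagrangian H J) :=
  continuous_supAffine (hH.isCompact_sublevel J) (hH.sublevel_nonempty hJ) hH.continuous

theorem convexOn_lagrangian (hH : PosConvex H) (hJ : 0 ≤ J) :
    ConvexOn ℝ univ (lagrangian H J) :=
  convexOn_supAffine (hH.isCompact_sublevel J) (hH.sublevel_nonempty hJ) hH.continuous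

theorem inner_sub_le_lagrangian (hH : PosConvex H) {p : E} (hp : H p ≤ J) (q : E) :
    inner ℝ p q - H p ≤ lagrangian H J q :=
  le_supAffine (hH.isCompact_sublevel J) hH.continuous (p := p) hp q

theorem lagrangian_nonneg (hH : PosConvex H) (hJ : 0 ≤ J) (q : E) : 0 ≤ lagrangian H J q := by
  simpa [hH.map_zero] using hH.inner_sub_le_lagrangian (hH.zero_mem_sublevel hJ) q

theorem lagrangian_zero (hH : PosConvex H) (hJ : 0 ≤ J) : lagrangian H J 0 = 0 :=
  le_antisymm (hH.lagrangian_le hJ fun p _ => by simpa using hH.nonneg p)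
    (hH.lagrangian_nonneg hJ 0)

/-- The Lagrangian is `o(q)` at the origin because `H` is positive away from the origin. -/
theorem eventually_mul_lagrangian_le (hH : PosConvex H) (hJ : 0 ≤ J) (d : E) {η : ℝ}
    (hη : 0 < η) : ∀ᶠ N : ℕ in atTop, N * lagrangian H J ((N : ℝ)⁻¹ • d) ≤ η := by
  obtain ⟨ε, hε, hεd⟩ : ∃ ε > 0, ‖d‖ * ε ≤ η :=
    ⟨η / (‖d‖ + 1), by positivity, by rw [mul_div_assoc', div_le_iff₀ (by positivity)]; nlinarith⟩
  obtain ⟨c, hc, hcH⟩ := hH.exists_mul_norm_sub_le hε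
  obtain ⟨N₀, hN₀⟩ := exists_nat_gt (‖d‖ / c)
  filter_upwards [eventually_ge_atTop N₀, eventually_gt_atTop 0] with N hN hNpos
  have hN0 : (0 : ℝ) < N := by exact_mod_cast hNpos
  have hdN : ‖d‖ ≤ N * c := ((div_lt_iff₀ hc).1 hN₀).le.trans (by gcongr)
  rw [← le_div_iff₀' hN0]
  refine hH.lagrangian_le hJ fun p _ => ?_
  rw [inner_smul_right, le_div_iff₀' hN0, mul_sub, mul_inv_cancel_left₀ hN0.ne']
  have hHp : ‖d‖ * (‖p‖ - ε) ≤ N * H p := by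
    rcases le_total ‖p‖ ε with hp | hp
    · exact (mul_nonpos_of_nonneg_of_nonpos (norm_nonneg d) (sub_nonpos.2 hp)).trans
        (mul_nonneg hN0.le (hH.nonneg p))
    · calc ‖d‖ * (‖p‖ - ε) ≤ N * c * (‖p‖ - ε) := by
            gcongr
        _ ≤ N * H p := by
            rw [mul_assoc]
            gcongr
            exact hcH p
  linarith [real_inner_le_norm p d]

theorem exists_lagrangian_smul_le (hH : PosConvex H) (hk : 0 < k) (hkJ : SteepAbove H k J) {z : E}
    (hz : z ≠ 0) :
    ∃ r > 0, r * ‖z‖ ≤ J ∧ lagrangian H J (r • z) ≤ r * cone H k z - k := by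
  have hJ : 0 ≤ J := hk.le.trans hkJ.lt.le
  obtain ⟨d, hd⟩ := exists_le_add_mul_sub_of_concaveOn (hH.concaveOn_cone z)
    (x := k) (by rwa [interior_Ici])
  have hnorm : ‖z‖ ≤ d * (J - k) := by linarith [hd J hJ, hkJ.cone_add_norm_le z]
  have hd_pos : 0 < d := pos_of_mul_pos_left ((norm_pos_iff.2 hz).trans_le hnorm)
    (sub_pos.2 hkJ.lt).le
  refine ⟨d⁻¹, inv_pos.2 hd_pos, ?_, hH.lagrangian_le hJ fun p _ => ?_⟩
  · rw [inv_mul_le_iff₀ hd_pos]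
    nlinarith
  · rw [inner_smul_right]
    calc d⁻¹ * inner ℝ p z - H p ≤ d⁻¹ * (cone H k z + d * (H p - k)) - H p := by
          gcongr
          exact (hH.inner_le_cone le_rfl z).trans (hd (H p) (hH.nonneg p))
      _ = d⁻¹ * cone H k z - k := by
          field_simp
          ring

end Lagrangian

section Contact

theorem continuous_youngGap (hH : PosConvex H) (hk : 0 ≤ k) (hJ : 0 ≤ J) :
    Continuous (youngGap H J k) :=
  ((hH.continuous_lagrangian hJ).add continuous_const).sub (hH.continuous_cone hk)

theorem youngGap_nonneg (hH : PosConvex H) (hk : 0 ≤ k) (hkJ : k ≤ J) (q : E) :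
    0 ≤ youngGap H J k q := by
  obtain ⟨p, hp, hpq⟩ := hH.exists_inner_eq_cone hk q
  rw [youngGap, ← hpq]
  linarith [hH.inner_sub_le_lagrangian (hp.trans hkJ) q]

theorem convexOn_youngGap_smul (hH : PosConvex H) (hk : 0 ≤ k) (hJ : 0 ≤ J) (q : E) :
    ConvexOn ℝ (Ici 0) fun s : ℝ => youngGap H J k (s • q) := by
  have hlag : ConvexOn ℝ (Ici 0) fun s : ℝ => lagrangian H J (s • q) :=
    ((hH.convexOn_lagrangian hJ).comp_linearMap (LinearMap.toSpanSingleton ℝ E q)).subset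
      (subset_univ _) (convex_Ici 0)
  have hlin : ConcaveOn ℝ (Ici 0) fun s : ℝ => s * cone H k q :=
    (LinearMap.mulRight ℝ (cone H k q)).concaveOn (convex_Ici 0)
  refine ((hlag.add_const k).sub hlin).congr fun s hs => ?_
  simp only [youngGap, hH.cone_smul hk hs, Pi.sub_apply, Pi.add_apply]

theorem exists_youngGap_smul_nonpos (hH : PosConvex H) (hk : 0 < k) (hkJ : SteepAbove H k J)
    {q : E} (hq : q ≠ 0) : ∃ r > 0, r * ‖q‖ ≤ J ∧ youngGap H J k (r • q) ≤ 0 := by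
  obtain ⟨r, hr, hrJ, hle⟩ := hH.exists_lagrangian_smul_le hk hkJ hq
  refine ⟨r, hr, hrJ, ?_⟩
  rw [youngGap, hH.cone_smul hk.le hr.le]
  linarith

theorem isOpen_preContact (hH : PosConvex H) (hk : 0 ≤ k) (hJ : 0 ≤ J) :
    IsOpen (preContact H J k) := by
  refine isOpen_iff_eventually.2 fun q hq => ?_
  refine isCompact_Icc.eventually_forall_of_forall_eventually fun s hs => ?_
  have hcont : Continuous fun z : E × ℝ => youngGap H J k (z.2 • z.1) :=
    (hH.continuous_youngGap hk hJ).comp (by fun_prop)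
  exact hcont.continuousAt.eventually_const_lt (hq s hs)

theorem exists_one_lt_youngGap_smul_nonpos (hH : PosConvex H) (hk : 0 < k)
    (hkJ : SteepAbove H k J) {q : E} (hq : q ∈ preContact H J k) (hq0 : q ≠ 0) :
    ∃ r > 1, r * ‖q‖ ≤ J ∧ youngGap H J k (r • q) ≤ 0 := by
  obtain ⟨r, hr, hrJ, hle⟩ := hH.exists_youngGap_smul_nonpos hk hkJ hq0
  refine ⟨r, ?_, hrJ, hle⟩
  by_contra! hr1
  exact (hq r ⟨hr.le, hr1⟩).not_ge hle

theorem preContact_subset_closedBall (hH : PosConvex H) (hk : 0 < k) (hkJ : SteepAbove H k J) :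
    preContact H J k ⊆ Metric.closedBall 0 J := fun q hq => by
  rw [mem_closedBall_zero_iff]
  rcases eq_or_ne q 0 with rfl | hq0
  · simpa using hk.le.trans hkJ.lt.le
  · obtain ⟨r, hr, hrJ, -⟩ := hH.exists_one_lt_youngGap_smul_nonpos hk hkJ hq hq0
    exact (le_mul_of_one_le_left (norm_nonneg q) hr.le).trans hrJ

theorem youngGap_le_youngGap_smul (hH : PosConvex H) (hk : 0 < k) (hkJ : SteepAbove H k J) {q : E}
    (hq : q ∈ closure (preContact H J k)) {s : ℝ} (hs : s ∈ Icc (0 : ℝ) 1) :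
    youngGap H J k q ≤ youngGap H J k (s • q) := by
  have hJ : 0 ≤ J := hk.le.trans hkJ.lt.le
  have hcont := hH.continuous_youngGap hk.le hJ
  refine closure_minimal (t := {q | youngGap H J k q ≤ youngGap H J k (s • q)}) (fun p hp => ?_)
    (isClosed_le hcont (hcont.comp (continuous_const_smul s))) hq
  rcases eq_or_ne p 0 with rfl | hp0
  · simp
  obtain ⟨r, hr, -, hle⟩ := hH.exists_one_lt_youngGap_smul_nonpos hk hkJ hp hp0
  have hmax := (hH.convexOn_youngGap_smul hk.le hJ p).le_max_of_mem_Icc hs.1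
    (zero_le_one.trans hr.le) (z := 1) ⟨hs.2, hr.le⟩
  simpa [one_smul, max_eq_left (hle.trans (hp s hs).le)] using hmax

theorem youngGap_nonpos_of_mem_frontier (hH : PosConvex H) (hk : 0 < k) (hkJ : SteepAbove H k J)
    {q : E} (hq : q ∈ frontier (preContact H J k)) : youngGap H J k q ≤ 0 := by
  have hopen := hH.isOpen_preContact hk.le (hk.le.trans hkJ.lt.le)
  rw [hopen.frontier_eq] at hq
  obtain ⟨s, hs, hle⟩ := notMem_preContact.1 hq.2
  exact (hH.youngGap_le_youngGap_smul hk hkJ hq.1 hs).trans hle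

/-- Past the contact point, Young's gap is convex and nonnegative with a zero behind. -/
theorem two_mul_lagrangian_add_le (hH : PosConvex H) (hk : 0 ≤ k) (hkJ : k ≤ J) {q : E}
    (hq : q ∉ preContact H J k) :
    2 * lagrangian H J q + k ≤ lagrangian H J ((2 : ℝ) • q) := by
  obtain ⟨s, hs, hle⟩ := notMem_preContact.1 hq
  have hconv := hH.convexOn_youngGap_smul hk (hk.trans hkJ) q
  have hgap2 := hH.youngGap_nonneg hk hkJ ((2 : ℝ) • q)
  have hreflect : youngGap H J k ((2 - s) • q) ≤ youngGap H J k ((2 : ℝ) • q) := by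
    have hmax := hconv.le_max_of_mem_Icc (z := 2 - s) hs.1 (zero_le_two (α := ℝ))
      ⟨by linarith [hs.2], by linarith [hs.1]⟩
    simpa [max_eq_right (hle.trans hgap2)] using hmax
  have hmid := hconv.2 (mem_Ici.2 hs.1) (mem_Ici.2 (by linarith [hs.2] : (0 : ℝ) ≤ 2 - s))
    (by norm_num : (0 : ℝ) ≤ 1 / 2) (by norm_num : (0 : ℝ) ≤ 1 / 2) (by norm_num)
  have hone : 1 / 2 * s + 1 / 2 * (2 - s) = 1 := by ring
  simp only [smul_eq_mul, hone, one_smul] at hmid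
  have hdouble : 2 * youngGap H J k q ≤ youngGap H J k ((2 : ℝ) • q) := by linarith
  rw [youngGap, youngGap, hH.cone_smul hk zero_le_two] at hdouble
  linarith

end Contact

end PosConvex

end Conjugate

section ConeComparison

theorem isOpen_sep_lt {X : Type*} [TopologicalSpace X] {V : Set X} {u w : X → ℝ} (hV : IsOpen V)
    (hu : ContinuousOn u V) (hw : ContinuousOn w V) : IsOpen {z ∈ V | w z < u z} := by
  refine isOpen_iff_mem_nhds.2 fun z hz => ?_
  have hVz := hV.mem_nhds hz.1
  filter_upwards [hVz, (hw.continuousAt hVz).eventually_lt (hu.continuousAt hVz) hz.2]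
    with y hyV hy using ⟨hyV, hy⟩

theorem eq_of_mem_frontier_sep_lt {X : Type*} [TopologicalSpace X] {V : Set X} {u w : X → ℝ}
    (hV : IsOpen V) (hu : ContinuousOn u (closure V)) (hw : ContinuousOn w (closure V))
    (hfr : ∀ z ∈ frontier V, u z ≤ w z) {z : X} (hz : z ∈ frontier {z ∈ V | w z < u z}) :
    w z = u z := by
  have hsub : {z ∈ V | w z < u z} ⊆ V := sep_subset _ _
  have hzcl : z ∈ closure V := closure_mono hsub hz.1
  have hopen := isOpen_sep_lt hV (hu.mono subset_closure) (hw.mono subset_closure)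
  rw [hopen.frontier_eq] at hz
  apply le_antisymm
  · exact ContinuousWithinAt.closure_le hz.1 ((hw z hzcl).mono (hsub.trans subset_closure))
      ((hu z hzcl).mono (hsub.trans subset_closure)) fun y hy => hy.2.le
  · by_cases hzV : z ∈ V
    · by_contra! hlt
      exact hz.2 ⟨hzV, hlt⟩
    · exact hfr z (hV.frontier_eq ▸ ⟨hzcl, hzV⟩)

theorem exists_first_exit {X : Type*} [TopologicalSpace X] {W : Set X} (hW : IsOpen W) {γ : ℝ → X}
    (hγ : Continuous γ) (h₀ : γ 0 ∈ W) (h₁ : γ 1 ∉ W) :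
    ∃ τ ∈ Ioc (0 : ℝ) 1, γ τ ∈ frontier W ∧ ∀ s ∈ Ico 0 τ, γ s ∈ W := by
  have hcompact : IsCompact (Icc (0 : ℝ) 1 ∩ γ ⁻¹' Wᶜ) :=
    isCompact_Icc.inter_right (hW.isClosed_compl.preimage hγ)
  obtain ⟨τ, ⟨hτ, hτW⟩, hleast⟩ := hcompact.exists_isLeast ⟨1, right_mem_Icc.2 zero_le_one, h₁⟩
  have hτ_pos : 0 < τ := hτ.1.lt_of_ne fun h => hτW (h ▸ h₀)
  have hbefore : ∀ s ∈ Ico 0 τ, γ s ∈ W := fun s hs => by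
    by_contra hsW
    exact hs.2.not_ge (hleast ⟨⟨hs.1, hs.2.le.trans hτ.2⟩, hsW⟩)
  have hτ_mem : τ ∈ closure (Ico 0 τ) := by
    rw [closure_Ico hτ_pos.ne]
    exact right_mem_Icc.2 hτ_pos.le
  exact ⟨τ, ⟨hτ_pos, hτ.2⟩, hW.frontier_eq ▸ ⟨map_mem_closure hγ hτ_mem hbefore, hτW⟩, hbefore⟩

/-- Comparison with cone functions from above: if `u z ≤ u x + cone H k (z - x)` on the boundary
of an open set `V` whose closure is a compact subset of `U`, then this holds in `V`. The vertex
`x` may lie anywhere. -/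
def ConeComparison {E : Type*} [NormedAddCommGroup E] [InnerProductSpace ℝ E] (H u : E → ℝ)
    (U : Set E) : Prop :=
  ∀ (V : Set E) (x : E) (k : ℝ), 0 ≤ k → IsOpen V → IsCompact (closure V) → closure V ⊆ U →
    (∀ z ∈ frontier V, u z ≤ u x + cone H k (z - x)) → ∀ z ∈ V, u z ≤ u x + cone H k (z - x)

variable {n : ℕ} {H u : EuclideanSpace ℝ (Fin n) → ℝ} {U : Set (EuclideanSpace ℝ (Fin n))}

theorem LipLoc.continuousOn (hU : IsOpen U) (hu : LipLoc u U) : ContinuousOn u U := by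
  intro x hx
  obtain ⟨r, hr, hrU⟩ := Metric.nhds_basis_closedBall.mem_iff.1 (hU.mem_nhds hx)
  have hcl : closure (Metric.ball x r) ⊆ Metric.closedBall x r :=
    Metric.closure_ball_subset_closedBall
  obtain ⟨K, hK⟩ := hu (Metric.ball x r) ⟨Metric.isOpen_ball,
    (isCompact_closedBall x r).of_isClosed_subset isClosed_closure hcl, hcl.trans hrU⟩
  exact (hK.continuousOn.continuousAt (Metric.ball_mem_nhds x hr)).continuousWithinAt

theorem PosConvex.map_gradient_le_of_forall_le_cone (hH : PosConvex H) {k : ℝ} (hk : 0 ≤ k)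
    {w : EuclideanSpace ℝ (Fin n) → ℝ} {x : EuclideanSpace ℝ (Fin n)}
    (hw : ∀ h, w (x + h) ≤ w x + cone H k h) : H (gradient w x) ≤ k := by
  by_cases hdiff : DifferentiableAt ℝ w x
  · refine hH.le_of_forall_inner_le_cone hk fun h => ?_
    rw [inner_gradient_left]
    refine le_of_tendsto (hdiff.hasFDerivAt.hasLineDerivAt h).tendsto_slope_zero_right ?_
    filter_upwards [self_mem_nhdsWithin] with s hs
    have hs_pos : 0 < s := hs
    rw [smul_eq_mul, inv_mul_le_iff₀ hs_pos, ← hH.cone_smul hk hs_pos.le]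
    exact sub_le_iff_le_add'.2 (hw _)
  · rw [gradient_eq_zero_of_not_differentiableAt hdiff, hH.map_zero]
    exact hk

theorem PosConvex.map_gradient_cone_le (hH : PosConvex H) {k : ℝ} (hk : 0 ≤ k) (a : ℝ)
    (x₀ x : EuclideanSpace ℝ (Fin n)) : H (gradient (fun z => a + cone H k (z - x₀)) x) ≤ k :=
  hH.map_gradient_le_of_forall_le_cone hk fun h => by
    have hadd := hH.cone_add_le hk (x - x₀) h
    rw [sub_add_eq_add_sub] at hadd
    linarith

theorem sub_le_cone_of_supHD_le (hH : PosConvex H) {W : Set (EuclideanSpace ℝ (Fin n))}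
    (hW : IsOpen W) {K : NNReal} (hu : LipschitzOnWith K u W) {k : ℝ}
    (hk : supHD H u W ≤ k) {y v : EuclideanSpace ℝ (Fin n)}
    (hseg : ∀ s ∈ Icc (0 : ℝ) 1, y + s • v ∈ W) : u (y + v) - u y ≤ cone H k v := by
  refine sub_le_of_ae_fderiv_le volume hW hu ?_ hseg
  have hae : ∀ᵐ x ∂volume.restrict W, ((H (gradient u x) : ℝ) : EReal) ≤ supHD H u W :=
    ae_le_essSup
  rw [ae_restrict_iff' hW.measurableSet] at hae
  filter_upwards [hae] with x hx hxW
  rw [← inner_gradient_left]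
  exact hH.inner_le_cone (EReal.coe_le_coe_iff.1 ((hx hxW).trans hk)) v

theorem sub_le_mul_cone_of_forall_Ico_mem (hH : PosConvex H)
    {W : Set (EuclideanSpace ℝ (Fin n))} (hW : IsOpen W) {K : NNReal} (hu : LipschitzOnWith K u W)
    {k : ℝ} (hk : 0 ≤ k) (hsup : supHD H u W ≤ k) {x v : EuclideanSpace ℝ (Fin n)} {τ : ℝ}
    (hτ : 0 < τ) (hcont : ContinuousAt u (x + τ • v)) (hseg : ∀ s ∈ Ico 0 τ, x + s • v ∈ W) :
    u x - u (x + τ • v) ≤ τ * cone H k (-v) := by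
  have hstep : ∀ s ∈ Ico 0 τ, u x - u (x + s • v) ≤ s * cone H k (-v) := fun s hs => by
    have hback := sub_le_cone_of_supHD_le hH hW hu hsup (y := x + s • v) (v := s • -v)
      fun r hr => by
        rw [show x + s • v + r • s • -v = x + (s * (1 - r)) • v by module]
        exact hseg _ ⟨mul_nonneg hs.1 (sub_nonneg.2 hr.2),
          (mul_le_of_le_one_right hs.1 (by linarith [hr.1])).trans_lt hs.2⟩
    rwa [hH.cone_smul hk hs.1, show x + s • v + s • -v = x by module] at hback
  have hτ_mem : τ ∈ closure (Ico 0 τ) := by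
    rw [closure_Ico hτ.ne]
    exact right_mem_Icc.2 hτ.le
  have hcomp : ContinuousAt (fun s : ℝ => u (x + s • v)) τ :=
    ContinuousAt.comp (f := fun s : ℝ => x + s • v) hcont (by fun_prop)
  exact ContinuousWithinAt.closure_le hτ_mem
    (continuousAt_const.sub hcomp).continuousWithinAt (by fun_prop) hstep

theorem AbsSubminimizing.supHD_le (hH : PosConvex H) (hu : AbsSubminimizing H u U) {k a : ℝ}
    (hk : 0 ≤ k) {W : Set (EuclideanSpace ℝ (Fin n))} (hW : CompactlyInside W U)
    {x₀ : EuclideanSpace ℝ (Fin n)} (hfr : ∀ z ∈ frontier W, a + cone H k (z - x₀) = u z)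
    (hle : ∀ z ∈ W, a + cone H k (z - x₀) ≤ u z) : supHD H u W ≤ k := by
  obtain ⟨L, hL⟩ := hH.exists_lipschitzWith_cone hk
  have hlip : LipschitzWith L fun z => a + cone H k (z - x₀) :=
    LipschitzWith.of_dist_le_mul fun y z => by simpa using hL.dist_le_mul (y - x₀) (z - x₀)
  refine (hu.2 W _ hW (fun V _ => ⟨L, hlip.lipschitzOnWith⟩) hlip.continuous.continuousOn hfr
    hle).trans (essSup_le_of_ae_le _ (Filter.Eventually.of_forall fun z => ?_))
  exact EReal.coe_le_coe_iff.2 (hH.map_gradient_cone_le hk a x₀ z)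

/-- Where `u` exceeds the cone function it has slope at most `k`; following the segment to the
vertex until it leaves this set yields a contradiction. -/
theorem AbsSubminimizing.coneComparison (hH : PosConvex H) (hU : IsOpen U)
    (hu : AbsSubminimizing H u U) : ConeComparison H u U := by
  intro V x₀ k hk hV hVc hVU hfr x hxV
  by_contra! hx
  have hcone := hH.continuous_cone hk
  have huU : ContinuousOn u U := hu.1.continuousOn hU
  have huV : ContinuousOn u (closure V) := huU.mono hVU
  have hwV : ContinuousOn (fun z => u x₀ + cone H k (z - x₀)) (closure V) := by fun_prop
  set W := {z ∈ V | u x₀ + cone H k (z - x₀) < u z}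
  have hcl : closure W ⊆ closure V := closure_mono (sep_subset _ _)
  have hW : CompactlyInside W U :=
    ⟨isOpen_sep_lt hV (huV.mono subset_closure) (hwV.mono subset_closure),
      hVc.of_isClosed_subset isClosed_closure hcl, hcl.trans hVU⟩
  have hWfr : ∀ z ∈ frontier W, u x₀ + cone H k (z - x₀) = u z := fun z hz =>
    eq_of_mem_frontier_sep_lt hV huV hwV hfr hz
  have hsup : supHD H u W ≤ k := hu.supHD_le hH hk hW hWfr fun z hz => hz.2.le
  have hx₀ : x₀ ∉ W := fun h => by simpa [hH.cone_zero hk] using h.2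
  obtain ⟨τ, hτ, hτfr, hτW⟩ := exists_first_exit hW.isOpen (γ := fun s => x + s • (x₀ - x))
    (by fun_prop) (by simpa using ⟨hxV, hx⟩) (by simpa using hx₀)
  obtain ⟨K, hK⟩ := hu.1 W hW
  have hgrowth := sub_le_mul_cone_of_forall_Ico_mem hH hW.isOpen hK hk hsup hτ.1
    (huU.continuousAt (hU.mem_nhds (hW.closure_subset hτfr.1))) hτW
  have hexit := hWfr _ hτfr
  rw [show x + τ • (x₀ - x) - x₀ = (1 - τ) • (x - x₀) by module,
    hH.cone_smul hk (sub_nonneg.2 hτ.2)] at hexit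
  rw [neg_sub] at hgrowth
  linarith

end ConeComparison

section SupConvolution

open Metric

/-- The points of `U` whose distance to the complement exceeds `r`, in the form that their closed
`r`-balls lie in `U`. -/
def erosion {X : Type*} [PseudoMetricSpace X] (U : Set X) (r : ℝ) : Set X :=
  {x | closedBall x r ⊆ U}

theorem erosion_subset {X : Type*} [PseudoMetricSpace X] {U : Set X} {r : ℝ} (hr : 0 ≤ r) :
    erosion U r ⊆ U := fun _ hx => hx (mem_closedBall_self hr)

theorem closedBall_subset_erosion {X : Type*} [PseudoMetricSpace X] {U : Set X} {x : X} {r s : ℝ}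
    (hx : x ∈ erosion U (r + s)) : closedBall x s ⊆ erosion U r := fun _ hy =>
  (closedBall_subset_closedBall' (by gcongr; exact hy)).trans hx

variable {E : Type*} [NormedAddCommGroup E] [InnerProductSpace ℝ E] {H u : E → ℝ} {U : Set E}
  {J k t ρ : ℝ} {x y : E}

/-- The action `t L((y - x) / t)` of a step from `x` to `y` in time `t`, with the truncated
Lagrangian of `H`. -/
noncomputable def stepCost (H : E → ℝ) (J t : ℝ) (x y : E) : ℝ :=
  t * lagrangian H J (t⁻¹ • (y - x))

/-- The sup-convolution of `u` at time `t`, localized to steps of length at most `ρ`. -/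
noncomputable def supConv (H : E → ℝ) (J t ρ : ℝ) (u : E → ℝ) (x : E) : ℝ :=
  sSup ((fun y => u y - stepCost H J t x y) '' closedBall x ρ)

open Classical in
/-- The sup-convolution, extended by the constant `-B` to the points where it would see values of
`u` too close to the boundary of `U`. -/
noncomputable def extSupConv (H : E → ℝ) (U : Set E) (J t ρ B : ℝ) (u : E → ℝ) : E → ℝ :=
  (erosion U (2 * ρ)).piecewise (supConv H J t ρ u) fun _ => -B

open Classical in
theorem extSupConv_of_mem {B : ℝ} (hx : x ∈ erosion U (2 * ρ)) :
    extSupConv H U J t ρ B u x = supConv H J t ρ u x :=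
  piecewise_eq_of_mem _ _ _ hx

open Classical in
theorem extSupConv_of_notMem {B : ℝ} (hx : x ∉ erosion U (2 * ρ)) :
    extSupConv H U J t ρ B u x = -B :=
  piecewise_eq_of_notMem _ _ _ hx

theorem stepCost_comp_neg (H : E → ℝ) (J t : ℝ) (x y : E) :
    stepCost (fun p => H (-p)) J t x y = stepCost H J t y x := by
  rw [stepCost, stepCost, lagrangian_comp_neg, ← smul_neg, neg_sub]

theorem stepCost_left_midpoint (H : E → ℝ) (J t : ℝ) (x z : E) :
    stepCost H J t x (midpoint ℝ x z) = stepCost H J (2 * t) x z / 2 := by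
  rw [stepCost, stepCost, midpoint_sub_left, smul_smul, invOf_eq_inv, mul_comm t⁻¹, ← mul_inv]
  ring

theorem stepCost_midpoint_right (H : E → ℝ) (J t : ℝ) (x z : E) :
    stepCost H J t (midpoint ℝ x z) z = stepCost H J (2 * t) x z / 2 := by
  rw [stepCost, stepCost, right_sub_midpoint, smul_smul, invOf_eq_inv, mul_comm t⁻¹, ← mul_inv]
  ring

theorem supConv_le (hρ : 0 ≤ ρ) {M : ℝ} (h : ∀ y ∈ closedBall x ρ, u y - stepCost H J t x y ≤ M) :
    supConv H J t ρ u x ≤ M :=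
  csSup_le ((nonempty_closedBall.2 hρ).image _) (forall_mem_image.2 h)

namespace PosConvex

variable [FiniteDimensional ℝ E]

theorem stepCost_nonneg (hH : PosConvex H) (hJ : 0 ≤ J) (ht : 0 ≤ t) (x y : E) :
    0 ≤ stepCost H J t x y :=
  mul_nonneg ht (hH.lagrangian_nonneg hJ _)

theorem stepCost_self (hH : PosConvex H) (hJ : 0 ≤ J) (x : E) : stepCost H J t x x = 0 := by
  rw [stepCost, sub_self, smul_zero, hH.lagrangian_zero hJ, mul_zero]

theorem continuous_stepCost (hH : PosConvex H) (hJ : 0 ≤ J) (x : E) :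
    Continuous (stepCost H J t x) :=
  continuous_const.mul ((hH.continuous_lagrangian hJ).comp (by fun_prop))

theorem mul_youngGap (hH : PosConvex H) (hk : 0 ≤ k) (ht : 0 < t) (x y : E) :
    t * youngGap H J k (t⁻¹ • (y - x)) = stepCost H J t x y + t * k - cone H k (y - x) := by
  rw [youngGap, hH.cone_smul hk (inv_nonneg.2 ht.le), mul_sub, mul_inv_cancel_left₀ ht.ne',
    mul_add, stepCost]

theorem cone_le_stepCost_add (hH : PosConvex H) (hk : 0 ≤ k) (hkJ : k ≤ J) (ht : 0 < t)
    (x y : E) : cone H k (y - x) ≤ stepCost H J t x y + t * k := by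
  rw [← sub_nonneg, ← hH.mul_youngGap hk ht]
  exact mul_nonneg ht.le (hH.youngGap_nonneg hk hkJ _)

theorem stepCost_two_mul_add_le (hH : PosConvex H) (hk : 0 ≤ k) (hkJ : k ≤ J) (ht : 0 < t)
    (h : (2 * t)⁻¹ • (y - x) ∉ preContact H J k) :
    stepCost H J (2 * t) x y + t * k ≤ stepCost H J t x y := by
  have hdouble := hH.two_mul_lagrangian_add_le hk hkJ h
  rw [smul_smul, mul_inv, mul_inv_cancel_left₀ two_ne_zero, ← mul_inv] at hdouble
  rw [stepCost, stepCost]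
  linarith [mul_le_mul_of_nonneg_left hdouble ht.le]

theorem stepCost_two_mul_le (hH : PosConvex H) (hJ : 0 ≤ J) (ht : 0 < t) (x y z : E) :
    stepCost H J (2 * t) x z ≤ stepCost H J t x y + stepCost H J t y z := by
  have hconv := (hH.convexOn_lagrangian hJ).2 (mem_univ (t⁻¹ • (y - x)))
    (mem_univ (t⁻¹ • (z - y))) (by norm_num : (0 : ℝ) ≤ 2⁻¹) (by norm_num : (0 : ℝ) ≤ 2⁻¹)
    (by norm_num)
  rw [show (2 : ℝ)⁻¹ • t⁻¹ • (y - x) + (2 : ℝ)⁻¹ • t⁻¹ • (z - y) = (2 * t)⁻¹ • (z - x) by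
    rw [mul_inv]; module, smul_eq_mul, smul_eq_mul] at hconv
  unfold stepCost
  linarith [mul_le_mul_of_nonneg_left hconv (by positivity : 0 ≤ 2 * t)]

theorem exists_eq_supConv (hH : PosConvex H) (hJ : 0 ≤ J) (hρ : 0 ≤ ρ)
    (hu : ContinuousOn u (closedBall x ρ)) :
    ∃ y ∈ closedBall x ρ, u y - stepCost H J t x y = supConv H J t ρ u x := by
  have := FiniteDimensional.proper_real E
  obtain ⟨y, hy, hmax⟩ := (isCompact_closedBall x ρ).exists_sSup_image_eq
    (nonempty_closedBall.2 hρ) (hu.sub (hH.continuous_stepCost (t := t) hJ x).continuousOn)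
  exact ⟨y, hy, hmax.symm⟩

theorem le_supConv (hH : PosConvex H) (hJ : 0 ≤ J) (hu : ContinuousOn u (closedBall x ρ))
    (hy : y ∈ closedBall x ρ) : u y - stepCost H J t x y ≤ supConv H J t ρ u x := by
  have := FiniteDimensional.proper_real E
  exact le_csSup ((isCompact_closedBall x ρ).bddAbove_image
    (hu.sub (hH.continuous_stepCost (t := t) hJ x).continuousOn)) (mem_image_of_mem _ hy)

theorem self_le_supConv (hH : PosConvex H) (hJ : 0 ≤ J) (hρ : 0 ≤ ρ)
    (hu : ContinuousOn u (closedBall x ρ)) : u x ≤ supConv H J t ρ u x := by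
  simpa [hH.stepCost_self hJ] using hH.le_supConv (t := t) hJ hu (mem_closedBall_self hρ)

theorem supConv_le_add (hH : PosConvex H) (hk : 0 ≤ k) (hkJ : k ≤ J) (ht : 0 < t) (hρ : 0 ≤ ρ)
    (hle : ∀ y ∈ closedBall x ρ, u y ≤ u x + cone H k (y - x)) :
    supConv H J t ρ u x ≤ u x + t * k :=
  supConv_le hρ fun y hy => by linarith [hle y hy, hH.cone_le_stepCost_add hk hkJ ht x y]

theorem mem_closedBall_of_le_sub_stepCost (hH : PosConvex H) (hk : 0 ≤ k)
    (hkJ : SteepAbove H k J) (ht : 0 < t) (hle : u y ≤ u x + cone H k (y - x))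
    (hxy : u x ≤ u y - stepCost H J t x y) : y ∈ closedBall x (t * J) := by
  rw [mem_closedBall_iff_norm]
  linarith [hkJ.cone_add_norm_le (y - x),
    hH.cone_le_stepCost_add (hk.trans hkJ.lt.le) le_rfl ht x y]

theorem supConv_sub_stepCost_le (hH : PosConvex H) (hJ : 0 ≤ J) (ht : 0 < t) (hρ : 0 ≤ ρ)
    (hu : ContinuousOn u (closedBall x (2 * ρ))) (hy : y ∈ closedBall x ρ) :
    supConv H J t ρ u y - stepCost H J t x y ≤ supConv H J (2 * t) (2 * ρ) u x := by
  rw [sub_le_iff_le_add]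
  refine supConv_le hρ fun z hz => ?_
  have hz₂ : z ∈ closedBall x (2 * ρ) :=
    closedBall_subset_closedBall' (by rw [two_mul]; gcongr; exact hy) hz
  linarith [hH.le_supConv (t := 2 * t) hJ hu hz₂, hH.stepCost_two_mul_le hJ ht x y z]

/-- The supremum at time `2 t` is reached in two equal steps. -/
theorem exists_supConv_sub_stepCost_eq (hH : PosConvex H) (hk : 0 ≤ k) (hkJ : SteepAbove H k J)
    (ht : 0 < t) (hρ : 0 ≤ ρ) (htρ : 2 * t * J ≤ ρ) (hu : ContinuousOn u (closedBall x (2 * ρ)))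
    (hle : ∀ y ∈ closedBall x (2 * ρ), u y ≤ u x + cone H k (y - x)) :
    ∃ y ∈ closedBall x ρ,
      supConv H J t ρ u y - stepCost H J t x y = supConv H J (2 * t) (2 * ρ) u x := by
  have hJ : 0 ≤ J := hk.trans hkJ.lt.le
  have hρ₂ : 0 ≤ 2 * ρ := by positivity
  obtain ⟨z, hz, hmax⟩ := hH.exists_eq_supConv (t := 2 * t) hJ hρ₂ hu
  have hzρ : z ∈ closedBall x ρ := closedBall_subset_closedBall htρ
    (hH.mem_closedBall_of_le_sub_stepCost hk hkJ (by positivity) (hle z hz)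
      (hmax ▸ hH.self_le_supConv hJ hρ₂ hu))
  have hdist : dist x z / 2 ≤ ρ / 2 := by gcongr; rwa [← mem_closedBall']
  have hmid : midpoint ℝ x z ∈ closedBall x (ρ / 2) := by
    rwa [mem_closedBall, dist_midpoint_left, Real.norm_ofNat, inv_mul_eq_div]
  have hz_mid : z ∈ closedBall (midpoint ℝ x z) ρ := by
    rw [mem_closedBall', dist_midpoint_right, Real.norm_ofNat, inv_mul_eq_div]
    linarith
  have hmid_cont : ContinuousOn u (closedBall (midpoint ℝ x z) ρ) :=
    hu.mono (closedBall_subset_closedBall' (by linarith [mem_closedBall.1 hmid]))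
  have hmidρ := closedBall_subset_closedBall (half_le_self hρ) hmid
  refine ⟨midpoint ℝ x z, hmidρ,
    (hH.supConv_sub_stepCost_le hJ ht hρ hu hmidρ).antisymm ?_⟩
  have hle_mid := hH.le_supConv (t := t) hJ hmid_cont hz_mid
  rw [stepCost_midpoint_right] at hle_mid
  rw [← hmax, stepCost_left_midpoint]
  linarith

end PosConvex

namespace ConeComparison

variable [FiniteDimensional ℝ E]

/-- Where the cost in time `2 t` exceeds the cone function of slope `k` minus `2 t k`, comparison
with cones is applied; elsewhere the action grows superlinearly along rays. -/
theorem sub_stepCost_le_add (hH : PosConvex H) (hu : ConeComparison H u U) (hk : 0 < k)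
    (hkJ : SteepAbove H k J) (ht : 0 < t) (htρ : 2 * t * J ≤ ρ) (hball : closedBall x ρ ⊆ U)
    (hle : ∀ z ∈ closedBall x ρ, u z ≤ u x + 2 * t * k + stepCost H J (2 * t) x z)
    (hy : y ∈ closedBall x ρ) : u y - stepCost H J t x y ≤ u x + t * k := by
  have := FiniteDimensional.proper_real E
  have ht₂ : 0 < 2 * t := by positivity
  have hφ : Continuous fun z => (2 * t)⁻¹ • (z - x) := by fun_prop
  set V := (fun z => (2 * t)⁻¹ • (z - x)) ⁻¹' preContact H J k
  have hVball : V ⊆ closedBall x ρ := fun z hz => by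
    have hnorm := hH.preContact_subset_closedBall hk hkJ hz
    rw [mem_closedBall_zero_iff, norm_smul, norm_inv, Real.norm_of_nonneg ht₂.le,
      inv_mul_le_iff₀ ht₂] at hnorm
    exact mem_closedBall_iff_norm.2 (hnorm.trans htρ)
  have hVcl : closure V ⊆ closedBall x ρ := closure_minimal hVball isClosed_closedBall
  have hVfr : ∀ z ∈ frontier V, u z ≤ u x + cone H k (z - x) := fun z hz => by
    have hgap := mul_nonpos_of_nonneg_of_nonpos ht₂.le
      (hH.youngGap_nonpos_of_mem_frontier hk hkJ (hφ.frontier_preimage_subset _ hz))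
    rw [hH.mul_youngGap hk.le ht₂] at hgap
    linarith [hle z (hVcl hz.1)]
  by_cases hyV : y ∈ V
  · have hcone := hu V x k hk.le
      ((hH.isOpen_preContact hk.le (hk.le.trans hkJ.lt.le)).preimage hφ)
      ((isCompact_closedBall x ρ).of_isClosed_subset isClosed_closure hVcl)
      (hVcl.trans hball) hVfr y hyV
    linarith [hH.cone_le_stepCost_add hk.le hkJ.lt.le ht x y]
  · linarith [hle y hy, hH.stepCost_two_mul_add_le hk.le hkJ.lt.le ht hyV]

theorem two_mul_supConv_le (hH : PosConvex H) (hu : ConeComparison H u U)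
    (huU : ContinuousOn u U) (hk : 0 ≤ k) (hkJ : SteepAbove H k J) (ht : 0 < t) (hρ : 0 ≤ ρ)
    (htρ : t * J ≤ ρ) (hball : closedBall x (2 * ρ) ⊆ U)
    (hlt : supConv H J (2 * t) (2 * ρ) u x < u x + 2 * t * k) :
    2 * supConv H J t ρ u x ≤ supConv H J (2 * t) (2 * ρ) u x + u x := by
  have hJ : 0 ≤ J := hk.trans hkJ.lt.le
  have ht₂ : 0 < 2 * t := by positivity
  have hu_ball := huU.mono hball
  have hself := hH.self_le_supConv (t := 2 * t) hJ (by positivity) hu_ball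
  by_contra! hgt
  obtain ⟨a, ha, ha_lt⟩ := exists_between (lt_min hlt (lt_sub_iff_add_lt.2 hgt))
  obtain ⟨hak, ha_lt⟩ := lt_min_iff.1 ha_lt
  obtain ⟨j, rfl⟩ : ∃ j, a = u x + 2 * t * j := ⟨(a - u x) / (2 * t), by field_simp; ring⟩
  have hj : 0 < j := pos_of_mul_pos_right (by linarith : 0 < 2 * t * j) ht₂.le
  have hjk : j ≤ k := le_of_mul_le_mul_left (by linarith : 2 * t * j ≤ 2 * t * k) ht₂
  have hbound : supConv H J t ρ u x ≤ u x + t * j := supConv_le hρ fun y hy =>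
    hu.sub_stepCost_le_add hH hj (hH.steepAbove_of_le hj.le hjk hkJ) ht
      (by linarith) hball
      (fun z hz => by linarith [hH.le_supConv (t := 2 * t) hJ hu_ball hz])
      (closedBall_subset_closedBall (by linarith) hy)
  linarith

theorem discreteSub_extSupConv (hH : PosConvex H) (hu : ConeComparison H u U)
    (huU : ContinuousOn u U) (hk : 0 ≤ k) (hkJ : SteepAbove H (k + 1) J) (ht : 0 < t) (hρ : 0 ≤ ρ)
    (htρ : 2 * t * J ≤ ρ) (B : ℝ)
    (hle : ∀ x ∈ erosion U (2 * ρ), ∀ y ∈ closedBall x (2 * ρ), u y ≤ u x + cone H k (y - x)) :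
    DiscreteSub (fun x y => dist x y ≤ ρ) (stepCost H J t) (extSupConv H U J t ρ B u)
      (fun x => supConv H J (2 * t) (2 * ρ) u x - supConv H J t ρ u x) (erosion U (3 * ρ)) := by
  have hJ : 0 ≤ J := by linarith [hkJ.lt]
  have hball : ∀ {x}, x ∈ erosion U (3 * ρ) → closedBall x ρ ⊆ erosion U (2 * ρ) := fun hx =>
    closedBall_subset_erosion (by rwa [show 2 * ρ + ρ = 3 * ρ by ring])
  have hself : ∀ {x}, x ∈ erosion U (3 * ρ) → x ∈ erosion U (2 * ρ) := fun hx =>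
    hball hx (mem_closedBall_self hρ)
  have hcont : ∀ {x}, x ∈ erosion U (2 * ρ) → ContinuousOn u (closedBall x (2 * ρ)) := fun hx =>
    huU.mono hx
  refine ⟨fun x hx y hy => ?_, fun x hx => ?_, fun x hx z hz => ?_⟩
  · rw [dist_comm] at hy
    rw [extSupConv_of_mem (hball hx hy), extSupConv_of_mem (hself hx), add_sub_cancel]
    exact hH.supConv_sub_stepCost_le hJ ht hρ (hcont (hself hx)) hy
  · have hle' : ∀ y ∈ closedBall x (2 * ρ), u y ≤ u x + cone H (k + 1) (y - x) := fun y hy =>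
      (hle x (hself hx) y hy).trans (by gcongr; exact hH.cone_mono hk (by linarith) _)
    obtain ⟨y, hy, heq⟩ := hH.exists_supConv_sub_stepCost_eq (by positivity) hkJ ht hρ htρ
      (hcont (hself hx)) hle'
    refine ⟨y, mem_closedBall'.1 hy, ?_⟩
    rw [extSupConv_of_mem (hball hx hy), extSupConv_of_mem (hself hx), heq, add_sub_cancel]
  · have hlt : supConv H J (2 * t) (2 * ρ) u x < u x + 2 * t * (k + 1) :=
      (hH.supConv_le_add hk (by linarith [hkJ.lt]) (by positivity) (by positivity)
        (hle x (hself hx))).trans_lt (by linarith)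
    have hconvex := hu.two_mul_supConv_le hH huU (by positivity) hkJ ht hρ (by nlinarith)
      (hself hx) hlt
    have hxz := hH.le_supConv (t := t) hJ
      ((hcont (hball hx hz)).mono (closedBall_subset_closedBall (by linarith)))
      (mem_closedBall'.2 hz)
    rw [extSupConv_of_mem (hball hx hz), extSupConv_of_mem (hself hx)]
    linarith

end ConeComparison

end SupConvolution

section Exterior

open Filter Metric

variable {E : Type*} [NormedAddCommGroup E] [InnerProductSpace ℝ E] {H H' u v : E → ℝ} {U : Set E}
  {B J t ρ : ℝ} {x : E}

theorem exists_forall_sub_lt_of_isCompact {X : Type*} [PseudoMetricSpace X] {A K : Set X}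
    {u v : X → ℝ} {c : ℝ} (hK : IsCompact K) (hKA : K ⊆ A) (hu : ContinuousOn u A)
    (hv : ContinuousOn v A) (h : ∀ p ∈ K, u p - v p < c) :
    ∃ δ > 0, ∀ p ∈ K, ∀ y ∈ A, ∀ z ∈ A, dist y p < δ → dist z p < δ → u y - v z < c := by
  have hlocal : ∀ p ∈ K, ∃ r > 0, ∀ y ∈ A, ∀ z ∈ A, dist y p < r → dist z p < r →
      u y - v z < c := fun p hp => by
    have hcont : ContinuousOn (fun q : X × X => u q.1 - v q.2) (A ×ˢ A) :=
      (hu.comp continuousOn_fst fun q hq => hq.1).sub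
        (hv.comp continuousOn_snd fun q hq => hq.2)
    obtain ⟨r, hr, hball⟩ := mem_nhdsWithin_iff.1
      ((hcont (p, p) ⟨hKA hp, hKA hp⟩).eventually_lt_const (h p hp))
    exact ⟨r, hr, fun y hy z hz hyp hzp =>
      hball (a := (y, z)) ⟨max_lt hyp hzp, mk_mem_prod hy hz⟩⟩
  choose! r hr hlt using hlocal
  obtain ⟨δ, hδ, hcover⟩ := lebesgue_number_lemma_of_metric (c := fun p : K => ball (p : X) (r p))
    hK (fun _ => isOpen_ball) fun p hp => mem_iUnion.2 ⟨⟨p, hp⟩, mem_ball_self (hr p hp)⟩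
  refine ⟨δ, hδ, fun p hp y hy z hz hyp hzp => ?_⟩
  obtain ⟨⟨q, hq⟩, hpq⟩ := hcover p hp
  exact hlt q hq y hy z hz (hpq hyp) (hpq hzp)

variable [FiniteDimensional ℝ E]

theorem exists_mem_frontier_dist_le_of_notMem_erosion {r : ℝ} (hx : x ∈ U)
    (hxr : x ∉ erosion U r) : ∃ p ∈ frontier U, dist x p ≤ r := by
  obtain ⟨y, hy, hyU⟩ := not_subset.1 hxr
  obtain ⟨p, hp, hdist⟩ := exists_mem_frontier_infDist_compl_eq_dist hx
    ((ne_univ_iff_exists_notMem U).2 ⟨y, hyU⟩)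
  exact ⟨p, hp, hdist.symm.trans_le ((infDist_le_dist_of_mem hyU).trans (mem_closedBall'.1 hy))⟩

theorem extSupConv_add_extSupConv_le_of_forall {c : ℝ} (hH : PosConvex H)
    (hH' : PosConvex H') (hJ : 0 ≤ J) (ht : 0 ≤ t) (hρ : 0 ≤ ρ) (hc : -(2 * B) ≤ c)
    (h : x ∈ erosion U (2 * ρ) → ∀ y ∈ closedBall x ρ, ∀ z ∈ closedBall x ρ, u y + v z ≤ c) :
    extSupConv H U J t ρ B u x + extSupConv H' U J t ρ B v x ≤ c := by
  by_cases hx : x ∈ erosion U (2 * ρ)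
  · rw [extSupConv_of_mem hx, extSupConv_of_mem hx, ← le_sub_iff_add_le]
    refine supConv_le hρ fun y hy => ?_
    rw [le_sub_comm]
    refine supConv_le hρ fun z hz => ?_
    linarith [h hx y hy z hz, hH.stepCost_nonneg hJ ht x y, hH'.stepCost_nonneg hJ ht x z]
  · rw [extSupConv_of_notMem hx, extSupConv_of_notMem hx]
    linarith

theorem extSupConv_le (hH : PosConvex H) (hJ : 0 ≤ J) (ht : 0 ≤ t)
    (hρ : 0 ≤ ρ) (hB : 0 ≤ B) (hu : ∀ y ∈ U, u y ≤ B) (x : E) :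
    extSupConv H U J t ρ B u x ≤ B := by
  by_cases hx : x ∈ erosion U (2 * ρ)
  · rw [extSupConv_of_mem hx]
    refine supConv_le hρ fun y hy => ?_
    have hyU : y ∈ U := hx (closedBall_subset_closedBall (by linarith) hy)
    linarith [hu y hyU, hH.stepCost_nonneg hJ ht x y]
  · rw [extSupConv_of_notMem hx]
    linarith

theorem le_extSupConv (hH : PosConvex H) (hJ : 0 ≤ J) (hρ : 0 ≤ ρ) (hu : ContinuousOn u U)
    (hx : x ∈ erosion U (2 * ρ)) : u x ≤ extSupConv H U J t ρ B u x := by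
  rw [extSupConv_of_mem hx]
  exact hH.self_le_supConv hJ hρ
    (hu.mono ((closedBall_subset_closedBall (by linarith)).trans hx))

/-- In small steps the cost of travelling is negligible because `lagrangian H J` is `o(q)`. -/
theorem PosConvex.exists_chain (hH : PosConvex H) {η : ℝ} (hJ : 0 ≤ J) (ht : 0 < t) (hρ : 0 < ρ)
    (hη : 0 < η) (x p : E) :
    ∃ (N : ℕ) (γ : ℕ → E), γ 0 = x ∧ γ N = p ∧ (∀ i < N, dist (γ i) (γ (i + 1)) ≤ ρ) ∧
      ∑ i ∈ Finset.range N, (stepCost H J t (γ i) (γ (i + 1)) +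
        stepCost H J t (γ (i + 1)) (γ i)) ≤ η := by
  have hη' : 0 < η / (2 * t) := by positivity
  obtain ⟨N, hforward, hbackward, hNρ, hN_pos⟩ :=
    ((hH.eventually_mul_lagrangian_le hJ (t⁻¹ • (p - x)) hη').and
    ((hH.eventually_mul_lagrangian_le hJ (-(t⁻¹ • (p - x))) hη').and
    ((eventually_ge_atTop ⌈‖p - x‖ / ρ⌉₊).and (eventually_gt_atTop 0)))).exists
  have hN : (0 : ℝ) < N := by exact_mod_cast hN_pos
  set γ : ℕ → E := fun i => x + ((i : ℝ) * (N : ℝ)⁻¹) • (p - x) with hγ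
  have hstep : ∀ i, γ (i + 1) - γ i = (N : ℝ)⁻¹ • (p - x) := fun i => by
    simp only [hγ, Nat.cast_add, Nat.cast_one]
    module
  refine ⟨N, γ, by simp [hγ], by simp [hγ, mul_inv_cancel₀ hN.ne'], fun i _ => ?_, ?_⟩
  · rw [dist_comm, dist_eq_norm, hstep, norm_smul, norm_inv, Real.norm_natCast,
      inv_mul_le_iff₀ hN, ← div_le_iff₀ hρ]
    exact Nat.ceil_le.1 hNρ
  · have hcost : ∀ i, stepCost H J t (γ i) (γ (i + 1)) + stepCost H J t (γ (i + 1)) (γ i) =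
        t * (lagrangian H J ((N : ℝ)⁻¹ • t⁻¹ • (p - x)) +
          lagrangian H J ((N : ℝ)⁻¹ • -(t⁻¹ • (p - x)))) := fun i => by
      rw [stepCost, stepCost, ← neg_sub (γ (i + 1)), hstep, smul_neg, smul_neg, smul_comm t⁻¹,
        mul_add]
    rw [Finset.sum_congr rfl fun i _ => hcost i, Finset.sum_const, Finset.card_range, nsmul_eq_mul]
    calc N * (t * (lagrangian H J ((N : ℝ)⁻¹ • t⁻¹ • (p - x)) +
          lagrangian H J ((N : ℝ)⁻¹ • -(t⁻¹ • (p - x)))))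
        = t * (N * lagrangian H J ((N : ℝ)⁻¹ • t⁻¹ • (p - x)) +
          N * lagrangian H J ((N : ℝ)⁻¹ • -(t⁻¹ • (p - x)))) := by ring
      _ ≤ t * (η / (2 * t) + η / (2 * t)) := by gcongr
      _ = η := by field_simp; ring

theorem DiscreteSub.extSupConv_add_extSupConv_le {s s' : E → ℝ} {c : ℝ}
    (hu : DiscreteSub (fun x y => dist x y ≤ ρ) (stepCost H J t) (extSupConv H U J t ρ B u) s
      (erosion U (3 * ρ)))
    (hv : DiscreteSub (fun x y => dist x y ≤ ρ) (stepCost (fun p => H (-p)) J t)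
      (extSupConv (fun p => H (-p)) U J t ρ B v) s' (erosion U (3 * ρ)))
    (hH : PosConvex H) (hJ : 0 ≤ J) (ht : 0 < t) (hρ : 0 < ρ) (hB : 0 ≤ B)
    (huB : ∀ x ∈ U, u x ≤ B) (hvB : ∀ x ∈ U, v x ≤ B) (hU : U ≠ univ) (hc : -(2 * B) ≤ c)
    (hlayer : ∀ x ∈ U \ erosion U (3 * ρ), ∀ y ∈ U ∩ closedBall x ρ, ∀ z ∈ U ∩ closedBall x ρ,
      u y + v z ≤ c) (x : E) :
    extSupConv H U J t ρ B u x + extSupConv (fun p => H (-p)) U J t ρ B v x ≤ c := by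
  have hN : ∀ y z : E, dist y z ≤ ρ → dist z y ≤ ρ := fun y z h => (dist_comm z y).trans_le h
  have hsuper := hv.discreteSuper_neg hN
  simp only [stepCost_comp_neg] at hsuper
  rw [← sub_neg_eq_add]
  refine hu.sub_le hN (hH.stepCost_nonneg hJ ht.le) hsuper
    ⟨B, forall_mem_range.2 (extSupConv_le hH hJ ht.le hρ.le hB huB)⟩
    ⟨-B, forall_mem_range.2 fun y =>
      neg_le_neg (extSupConv_le hH.comp_neg hJ ht.le hρ.le hB hvB y)⟩
    (fun y hy => ?_) (fun y η hη => ?_) x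
  · rw [sub_neg_eq_add]
    refine extSupConv_add_extSupConv_le_of_forall hH hH.comp_neg hJ ht.le hρ.le hc
      fun hy₂ z hz w hw => ?_
    have hball : closedBall y ρ ⊆ U := (closedBall_subset_closedBall (by linarith)).trans hy₂
    exact hlayer y ⟨hball (mem_closedBall_self hρ.le), hy⟩ z ⟨hball hz, hz⟩ w ⟨hball hw, hw⟩
  · obtain ⟨p, hp⟩ := (ne_univ_iff_exists_notMem U).1 hU
    obtain ⟨k, γ, hγ₀, hγk, hγρ, hcost⟩ := hH.exists_chain hJ ht hρ hη y p
    exact ⟨k, γ, hγ₀, fun h => hp (hγk ▸ erosion_subset (by positivity) h), hγρ, hcost⟩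

namespace ConeComparison

theorem exists_le_add_cone (hH : PosConvex H) (hu : ConeComparison H u U) {R : ℝ} (hR : 0 < R)
    (hB : ∀ x ∈ U, |u x| ≤ B) :
    ∃ k, 0 ≤ k ∧ ∀ x ∈ erosion U R, ∀ y ∈ closedBall x R, u y ≤ u x + cone H k (y - x) := by
  have := FiniteDimensional.proper_real E
  obtain ⟨k, hk, hsteep⟩ := hH.exists_mul_norm_le_cone (2 * B / R)
  refine ⟨k, hk, fun x hx y hy => ?_⟩
  have hsphere : ∀ z ∈ sphere x R, u z ≤ u x + cone H k (z - x) := fun z hz => by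
    have hcone := hsteep k le_rfl (z - x)
    rw [mem_sphere_iff_norm.1 hz, div_mul_cancel₀ _ hR.ne'] at hcone
    linarith [(abs_le.1 (hB z (hx (sphere_subset_closedBall hz)))).2,
      (abs_le.1 (hB x (hx (mem_closedBall_self hR.le)))).1]
  rcases (mem_closedBall.1 hy).lt_or_eq with hlt | heq
  · have hcl : closure (ball x R) ⊆ closedBall x R := closure_ball_subset_closedBall
    exact hu (ball x R) x k hk isOpen_ball
      ((isCompact_closedBall x R).of_isClosed_subset isClosed_closure hcl) (hcl.trans hx)
      (fun z hz => hsphere z (frontier_ball_subset_sphere hz)) y hlt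
  · exact hsphere y heq

theorem exists_forall_discreteSub (hH : PosConvex H) (hu : ConeComparison H u U)
    (huU : ContinuousOn u U) (hB : ∀ x ∈ U, |u x| ≤ B) (hρ : 0 < ρ) :
    ∃ J₀, 0 ≤ J₀ ∧ ∀ J > J₀, ∀ t > 0, 2 * t * J ≤ ρ → ∃ s : E → ℝ,
      DiscreteSub (fun x y => dist x y ≤ ρ) (stepCost H J t) (extSupConv H U J t ρ B u) s
        (erosion U (3 * ρ)) := by
  obtain ⟨k, hk, hle⟩ := hu.exists_le_add_cone hH (mul_pos two_pos hρ) hB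
  obtain ⟨J₀, hJ₀, hsteep⟩ := hH.exists_forall_steepAbove (by positivity : 0 ≤ k + 1)
  exact ⟨J₀, hJ₀, fun J hJ t ht htρ =>
    ⟨_, hu.discreteSub_extSupConv hH huU hk (hsteep J hJ) ht hρ.le htρ B hle⟩⟩

theorem sub_le_of_forall_boundaryLayer (hH : PosConvex H) (hu : ConeComparison H u U)
    (hv : ConeComparison (fun p => H (-p)) (fun x => -v x) U) (huU : ContinuousOn u U)
    (hvU : ContinuousOn v U) (huB : ∀ x ∈ U, |u x| ≤ B) (hvB : ∀ x ∈ U, |v x| ≤ B) (hρ : 0 < ρ)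
    (hU : U ≠ univ) {c : ℝ} (hc : -(2 * B) ≤ c)
    (hlayer : ∀ x ∈ U \ erosion U (3 * ρ), ∀ y ∈ U ∩ closedBall x ρ, ∀ z ∈ U ∩ closedBall x ρ,
      u y - v z ≤ c) (hx : x ∈ U) : u x - v x ≤ c := by
  by_cases hxρ : x ∈ erosion U (2 * ρ)
  swap
  · have hx_mem : x ∈ U ∩ closedBall x ρ := ⟨hx, mem_closedBall_self hρ.le⟩
    refine hlayer x ⟨hx, fun h => hxρ ?_⟩ x hx_mem x hx_mem
    exact (closedBall_subset_closedBall (by linarith)).trans h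
  have hB : 0 ≤ B := (abs_nonneg _).trans (huB x hx)
  have hnegU : ContinuousOn (fun y => -v y) U := hvU.neg
  have hnegB : ∀ y ∈ U, |-v y| ≤ B := fun y hy => (abs_neg (v y)).trans_le (hvB y hy)
  obtain ⟨J₁, hJ₁, hsub⟩ := hu.exists_forall_discreteSub hH huU huB hρ
  obtain ⟨J₂, -, hsub'⟩ := hv.exists_forall_discreteSub hH.comp_neg hnegU hnegB hρ
  obtain ⟨J, hJ⟩ := exists_gt (max J₁ J₂)
  obtain ⟨hJ₁_lt, hJ₂_lt⟩ := max_lt_iff.1 hJ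
  have hJ_pos : 0 < J := hJ₁.trans_lt hJ₁_lt
  obtain ⟨t, ht, htρ⟩ : ∃ t > 0, 2 * t * J ≤ ρ :=
    ⟨ρ / (2 * J), by positivity, by field_simp; rfl⟩
  obtain ⟨s, hs⟩ := hsub J hJ₁_lt t ht htρ
  obtain ⟨s', hs'⟩ := hsub' J hJ₂_lt t ht htρ
  have hdiscrete := hs.extSupConv_add_extSupConv_le hs' hH hJ_pos.le ht hρ hB
    (fun y hy => (abs_le.1 (huB y hy)).2) (fun y hy => (abs_le.1 (hnegB y hy)).2) hU hc hlayer x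
  linarith [le_extSupConv (t := t) (B := B) hH hJ_pos.le hρ.le huU hxρ,
    le_extSupConv (t := t) (B := B) hH.comp_neg hJ_pos.le hρ.le hnegU hxρ]

theorem sub_le (hH : PosConvex H) (hu : ConeComparison H u U)
    (hv : ConeComparison (fun p => H (-p)) (fun x => -v x) U) (hU : (frontier U).Nonempty)
    (hU_compact : IsCompact (frontier U)) (hu_cont : ContinuousOn u (closure U))
    (hv_cont : ContinuousOn v (closure U)) (huB : ∀ x ∈ closure U, |u x| ≤ B)
    (hvB : ∀ x ∈ closure U, |v x| ≤ B) {m : ℝ} (hm : ∀ y ∈ frontier U, u y - v y ≤ m)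
    (hx : x ∈ U) : u x - v x ≤ m := by
  refine le_of_forall_pos_le_add fun ε hε => ?_
  obtain ⟨δ, hδ, hlt⟩ := exists_forall_sub_lt_of_isCompact hU_compact frontier_subset_closure
    hu_cont hv_cont (c := m + ε) fun p hp => by linarith [hm p hp]
  obtain ⟨p, hp⟩ := hU
  have hp_cl := frontier_subset_closure hp
  refine hu.sub_le_of_forall_boundaryLayer (ρ := δ / 5) (B := B) hH hv
    (hu_cont.mono subset_closure) (hv_cont.mono subset_closure)
    (fun y hy => huB y (subset_closure hy)) (fun y hy => hvB y (subset_closure hy))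
    (by positivity) (by rintro rfl; simp at hp) ?_ ?_ hx
  · linarith [hm p hp, (abs_le.1 (huB p hp_cl)).1, (abs_le.1 (hvB p hp_cl)).2]
  · rintro y ⟨hy, hyρ⟩ z hz w hw
    obtain ⟨q, hq, hyq⟩ := exists_mem_frontier_dist_le_of_notMem_erosion hy hyρ
    have hdist : ∀ a ∈ closedBall y (δ / 5), dist a q < δ := fun a ha => by
      linarith [dist_triangle a y q, mem_closedBall.1 ha]
    exact (hlt q hq z (subset_closure hz.1) w (subset_closure hw.1) (hdist z hz.2)
      (hdist w hw.2)).le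

end ConeComparison

end Exterior

section Euclidean

variable {n : ℕ} {H v : EuclideanSpace ℝ (Fin n) → ℝ} {U : Set (EuclideanSpace ℝ (Fin n))}

theorem IsHamiltonian.posConvex (hH : IsHamiltonian H) (hH0 : H ⁻¹' {0} = {0}) : PosConvex H where
  convex := hH.convex
  map_zero := hH.map_zero
  pos p hp := (hH.nonneg p).lt_of_ne' fun h => hp (hH0.subset h)

theorem supHD_comp_neg (H v : EuclideanSpace ℝ (Fin n) → ℝ)
    (V : Set (EuclideanSpace ℝ (Fin n))) :
    supHD (fun p => H (-p)) (fun x => -v x) V = supHD H v V := by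
  have hgrad : ∀ x, gradient (fun x => -v x) x = -gradient v x := fun x => by
    simp [gradient, fderiv_fun_neg]
  simp only [supHD, hgrad, neg_neg]

theorem LipLoc.neg (hv : LipLoc v U) : LipLoc (fun x => -v x) U := fun V hV =>
  (hv V hV).imp fun _ hK => hK.neg

theorem AbsSuperminimizing.neg (hv : AbsSuperminimizing H v U) :
    AbsSubminimizing (fun p => H (-p)) (fun x => -v x) U := by
  refine ⟨hv.1.neg, fun V w hV hw hw_cont hfr hle => ?_⟩
  have hmin := hv.2 V (fun x => -w x) hV hw.neg hw_cont.neg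
    (fun x hx => by rw [hfr x hx, neg_neg]) fun x hx => le_neg.1 (hle x hx)
  rw [← supHD_comp_neg H v, ← supHD_comp_neg H (fun x => -w x)] at hmin
  simpa only [neg_neg] using hmin

end Euclidean

end ExteriorComparison

theorem mainTheorem6_general {n : ℕ} (H : EuclideanSpace ℝ (Fin n) → ℝ)
    (hH : ExteriorComparison.PosConvex H)
    (U : Set (EuclideanSpace ℝ (Fin n))) (hU : IsOpen U)
    (hbd_nonempty : (frontier U).Nonempty) (hbd_compact : IsCompact (frontier U))
    (u v : EuclideanSpace ℝ (Fin n) → ℝ)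
    (hu_cont : ContinuousOn u (closure U)) (hv_cont : ContinuousOn v (closure U))
    (hu_bdd : Bornology.IsBounded (u '' closure U))
    (hv_bdd : Bornology.IsBounded (v '' closure U))
    (hu : ExteriorComparison.AbsSubminimizing H u U)
    (hv : ExteriorComparison.AbsSuperminimizing H v U) :
    ∃ M : ℝ, IsGreatest ((fun y => u y - v y) '' frontier U) M ∧
      ∀ x ∈ U, u x - v x ≤ M := by
  obtain ⟨M, hM⟩ := (hbd_compact.image_of_continuousOn
    ((hu_cont.sub hv_cont).mono frontier_subset_closure)).exists_isGreatest (hbd_nonempty.image _)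
  obtain ⟨B₁, hB₁⟩ := hu_bdd.exists_norm_le
  obtain ⟨B₂, hB₂⟩ := hv_bdd.exists_norm_le
  have hu_cone := hu.coneComparison hH hU
  have hv_cone := hv.neg.coneComparison hH.comp_neg hU
  exact ⟨M, hM, fun x hx => hu_cone.sub_le (B := max B₁ B₂) hH hv_cone hbd_nonempty hbd_compact
    hu_cont hv_cont (fun y hy => (hB₁ _ (mem_image_of_mem u hy)).trans (le_max_left _ _))
    (fun y hy => (hB₂ _ (mem_image_of_mem v hy)).trans (le_max_right _ _))
    (fun y hy => hM.2 (mem_image_of_mem _ hy)) hx⟩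

theorem mainTheorem6 {n : ℕ} (H : EuclideanSpace ℝ (Fin n) → ℝ)
    (hH : ExteriorComparison.IsHamiltonian H) (hH0 : H ⁻¹' {0} = {0})
    (U : Set (EuclideanSpace ℝ (Fin n))) (hU : IsOpen U)
    (hU_unbounded : ¬ Bornology.IsBounded U)
    (hbd_nonempty : (frontier U).Nonempty) (hbd_compact : IsCompact (frontier U))
    (u v : EuclideanSpace ℝ (Fin n) → ℝ)
    (hu_cont : ContinuousOn u (closure U)) (hv_cont : ContinuousOn v (closure U))
    (hu_bdd : Bornology.IsBounded (u '' closure U))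
    (hv_bdd : Bornology.IsBounded (v '' closure U))
    (hu : ExteriorComparison.AbsSubminimizing H u U)
    (hv : ExteriorComparison.AbsSuperminimizing H v U) :
    ∃ M : ℝ, IsGreatest ((fun y => u y - v y) '' frontier U) M ∧
      ∀ x ∈ U, u x - v x ≤ M :=
  mainTheorem6_general H (hH.posConvex hH0) U hU hbd_nonempty hbd_compact u v hu_cont hv_cont hu_bdd
    hv_bdd hu hv
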